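/- Let $\Omega\subset\mathbb R^n$ be a domain (any open set is allowed) and let $\varphi:\Omega\to\mathbb R$ be smooth. Let $L^2(\Omega,\varphi)$ be the space of measurable $f:\Omega\to\mathbb C$ with $\|f\|_\varphi^2=\int_\Omega|f|^2e^{-\varphi}\,d\lambda<\infty$, let $H^1(\Omega,\varphi)$ be the space of all $f\in L^2(\Omega,\varphi)$ whose distributional derivatives $\partial f/\partial x_j$, $1\le j\le n$, lie in $L^2(\Omega,\varphi)$, with norm $\|f\|_{1,\varphi}^2=\|f\|_\varphi^2+\sum_{j=1}^n\|\partial f/\partial x_j\|_\varphi^2$, and let $H^1_0(\Omega,\varphi)$ be the closure of $C_0^\infty(\Omega)$ in $H^1(\Omega,\varphi)$. Put $$V_1=\tfrac14|\nabla\varphi|^2-\tfrac12\Delta\varphi .$$ An operator $A$ has compact resolvent if $(A-z)^{-1}$ exists as a bounded, everywhere defined operator and is compact for some $z\in\mathbb C$. The operator $-\Delta+V_1$ with domain $C_0^\infty(\Omega)$ in $L^2(\Omega)$ (Lebesgue measure) is symmetric and nonnegative. Its *Dirichlet realization* is its Friedrichs extension. Its *Neumann realization* is the operator in $L^2(\Omega)$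 associated with the closed form $$q(u,v)=\int_\Omega\big(\nabla u+\tfrac12u\nabla\varphi\big)\cdot\overline{\big(\nabla v+\tfrac12v\nabla\varphi\big)}\,d\lambda,\qquad D(q)=\{u\in L^2(\Omega):\ \nabla u+\tfrac12u\nabla\varphi\in L^2(\Omega)^n\}$$ (derivatives in the sense of distributions). That is, its domain consists of all $u\in D(q)$ with $-\Delta u+V_1u\in L^2(\Omega)$ in the sense of distributions and $q(u,v)=\int_\Omega(-\Delta u+V_1u)\,\overline v\,d\lambda$ for all $v\in D(q)$, and it acts as $u\mapsto-\Delta u+V_1u$. Then: 1. The injection $H^1_0(\Omega,\varphi)\hookrightarrow L^2(\Omega,\varphi)$ is compact if and only if the Dirichlet realization of $-\Delta+V_1$ has compact resolvent. 2. The injection $H^1(\Omega,\varphi)\hookrightarrow L^2(\Omega,\varphi)$ is compact if and only if the Neumann realization of $-\Delta+V_1$ has compact resolvent. -/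

import Mathlib

open Set Filter Topology MeasureTheory TopologicalSpace
open scoped ContDiff InnerProductSpace Distributions Laplacian LinearPMap

noncomputable section

namespace WeightedSobolev

/-! ### Unbounded operators -/

section Operators

variable {H : Type*} [NormedAddCommGroup H] [InnerProductSpace ℂ H]

/-- The bounded operator `R` is the resolvent `(A - z)⁻¹` of the (unbounded) operator `A`,
that is, a two-sided inverse of the map `A - z` from the domain of `A` to `H`. -/
def IsResolventAt (A : H →ₗ.[ℂ] H) (z : ℂ) (R : H →L[ℂ] H) : Prop :=
  (∀ x : A.domain, R (A x - z • (x : H)) = x) ∧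
    ∀ y : H, ∃ x : A.domain, (x : H) = R y ∧ A x - z • (x : H) = y

/-- `A` has compact resolvent: `(A - z)⁻¹` is compact for some `z` outside the spectrum. -/
def HasCompactResolvent (A : H →ₗ.[ℂ] H) : Prop :=
  ∃ (z : ℂ) (R : H →L[ℂ] H), IsResolventAt A z R ∧ IsCompactOperator R

/-- The quadratic form of `S` is real and nonnegative on the domain of `S`. -/
def IsNonnegOperator (S : H →ₗ.[ℂ] H) : Prop :=
  ∀ x : S.domain, ∃ r : ℝ, 0 ≤ r ∧ ⟪(x : H), S x⟫_ℂ = (r : ℂ)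

theorem IsNonnegOperator.norm_add_le {S : H →ₗ.[ℂ] H} (hS : IsNonnegOperator S)
    (a b : S.domain) :
    ‖⟪((a + b : S.domain) : H), S (a + b)⟫_ℂ‖ ≤
      2 * ‖⟪(a : H), S a⟫_ℂ‖ + 2 * ‖⟪(b : H), S b⟫_ℂ‖ := by
  obtain ⟨r, hr, er⟩ := hS (a + b)
  obtain ⟨s, hs, es⟩ := hS (a - b)
  obtain ⟨p, hp, ep⟩ := hS a
  obtain ⟨q, hq, eq⟩ := hS b
  have key : ⟪((a + b : S.domain) : H), S (a + b)⟫_ℂ + ⟪((a - b : S.domain) : H), S (a - b)⟫_ℂ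
      = 2 * ⟪(a : H), S a⟫_ℂ + 2 * ⟪(b : H), S b⟫_ℂ := by
    simp only [LinearPMap.map_add, LinearPMap.map_sub, Submodule.coe_add, Submodule.coe_sub,
      inner_add_left, inner_add_right, inner_sub_left, inner_sub_right]
    ring
  rw [er, es, ep, eq] at key
  have key' : r + s = 2 * p + 2 * q := by exact_mod_cast key
  rw [er, ep, eq]
  simp only [Complex.norm_real, Real.norm_eq_abs, abs_of_nonneg hr, abs_of_nonneg hp,
    abs_of_nonneg hq]
  linarith

/-- The form domain of a nonnegative symmetric operator `S`, i.e. the domain of the closure of the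
form `x ↦ ⟪x, S x⟫`: limits in `H` of sequences in the domain of `S` that are Cauchy for
the form. -/
def formDomain (S : H →ₗ.[ℂ] H) (hS : IsNonnegOperator S) : Submodule ℂ H where
  carrier := {u | ∃ x : ℕ → S.domain,
    Tendsto (fun k => (x k : H)) atTop (𝓝 u) ∧
    Tendsto (fun p : ℕ × ℕ => ⟪((x p.1 - x p.2 : S.domain) : H), S (x p.1 - x p.2)⟫_ℂ)
      atTop (𝓝 0)}
  zero_mem' := ⟨fun _ => 0, by simp, by simp⟩
  add_mem' := by
    rintro u v ⟨x, hx, hx'⟩ ⟨y, hy, hy'⟩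
    refine ⟨fun k => x k + y k, by simpa using hx.add hy, ?_⟩
    have hb := (hx'.norm.const_mul 2).add (hy'.norm.const_mul 2)
    simp only [norm_zero, mul_zero, add_zero] at hb
    refine squeeze_zero_norm (fun p => ?_) hb
    have := hS.norm_add_le (x p.1 - x p.2) (y p.1 - y p.2)
    rwa [show (x p.1 - x p.2) + (y p.1 - y p.2) = x p.1 + y p.1 - (x p.2 + y p.2) by abel] at this
  smul_mem' := by
    rintro c u ⟨x, hx, hx'⟩
    refine ⟨fun k => c • x k, by simpa using hx.const_smul c, ?_⟩
    have hb := hx'.const_mul (star c * c)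
    rw [mul_zero] at hb
    refine hb.congr fun p => ?_
    rw [← smul_sub, LinearPMap.map_smul, Submodule.coe_smul, inner_smul_left, inner_smul_right]
    rw [mul_assoc]
    rfl

/-- The Friedrichs extension of a densely defined nonnegative symmetric operator `S`:
the restriction of the adjoint of `S` to the form domain. -/
def friedrichsExtension [CompleteSpace H] (S : H →ₗ.[ℂ] H) (hS : IsNonnegOperator S) :
    H →ₗ.[ℂ] H :=
  (S†).domRestrict (formDomain S hS)

end Operators

/-! ### Weak derivatives -/

variable {n : ℕ}

/-- The `j`-th (classical) partial derivative. -/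
def partialDeriv {F : Type*} [NormedAddCommGroup F] [NormedSpace ℝ F] (j : Fin n)
    (f : EuclideanSpace ℝ (Fin n) → F) (x : EuclideanSpace ℝ (Fin n)) : F :=
  fderiv ℝ f x (EuclideanSpace.single j 1)

/-- `∂f/∂x_j = g` on `Ω` in the sense of distributions. -/
def HasWeakPartialDeriv (Ω : Opens (EuclideanSpace ℝ (Fin n))) (j : Fin n)
    (f g : EuclideanSpace ℝ (Fin n) → ℂ) : Prop :=
  LocallyIntegrableOn f Ω ∧ LocallyIntegrableOn g Ω ∧
    ∀ ψ : 𝓓(Ω, ℂ), ∫ x in Ω, f x * partialDeriv j ψ x = -∫ x in Ω, g x * ψ x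

variable {Ω : Opens (EuclideanSpace ℝ (Fin n))} {j : Fin n}

theorem continuous_partialDeriv_test (ψ : 𝓓(Ω, ℂ)) : Continuous (partialDeriv j ψ) :=
  ((ψ.contDiff.continuous_fderiv (by simp)).clm_apply continuous_const)

theorem integrableOn_mul_of_tsupport_subset {f χ : EuclideanSpace ℝ (Fin n) → ℂ}
    (hf : LocallyIntegrableOn f Ω) (hχ : Continuous χ) (ψ : 𝓓(Ω, ℂ))
    (hs : Function.support χ ⊆ tsupport ψ) : IntegrableOn (fun x => f x * χ x) Ω := by
  have hK : IsCompact (tsupport ψ) := ψ.hasCompactSupport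
  have h1 : IntegrableOn (fun x => f x * χ x) (tsupport ψ) :=
    (hf.integrableOn_compact_subset ψ.tsupport_subset hK).mul_continuousOn hχ.continuousOn hK
  have h2 : Integrable (fun x => f x * χ x) := by
    rwa [integrableOn_iff_integrable_of_support_subset] at h1
    exact (Function.support_mul_subset_right _ _).trans hs
  exact h2.integrableOn

theorem support_partialDeriv_subset (ψ : 𝓓(Ω, ℂ)) :
    Function.support (partialDeriv j ψ) ⊆ tsupport ψ := by
  intro x hx
  refine support_fderiv_subset ℝ (fun h => hx ?_)
  simp [partialDeriv, h]

theorem HasWeakPartialDeriv.add {f f' g g' : EuclideanSpace ℝ (Fin n) → ℂ}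
    (h : HasWeakPartialDeriv Ω j f g) (h' : HasWeakPartialDeriv Ω j f' g') :
    HasWeakPartialDeriv Ω j (f + f') (g + g') := by
  refine ⟨h.1.add h'.1, h.2.1.add h'.2.1, fun ψ => ?_⟩
  have e := h.2.2 ψ
  have e' := h'.2.2 ψ
  simp only [Pi.add_apply, add_mul]
  rw [integral_add, integral_add, e, e', neg_add]
  all_goals
    first
    | exact integrableOn_mul_of_tsupport_subset h.1 (continuous_partialDeriv_test ψ) ψ
        (support_partialDeriv_subset ψ)
    | exact integrableOn_mul_of_tsupport_subset h'.1 (continuous_partialDeriv_test ψ) ψ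
        (support_partialDeriv_subset ψ)
    | exact integrableOn_mul_of_tsupport_subset h.2.1 ψ.continuous ψ (subset_tsupport _)
    | exact integrableOn_mul_of_tsupport_subset h'.2.1 ψ.continuous ψ (subset_tsupport _)

theorem HasWeakPartialDeriv.smul (c : ℂ) {f g : EuclideanSpace ℝ (Fin n) → ℂ}
    (h : HasWeakPartialDeriv Ω j f g) : HasWeakPartialDeriv Ω j (c • f) (c • g) := by
  refine ⟨h.1.smul c, h.2.1.smul c, fun ψ => ?_⟩
  simp only [Pi.smul_apply, smul_eq_mul, mul_assoc, integral_const_mul]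
  rw [h.2.2 ψ, mul_neg]

theorem HasWeakPartialDeriv.congr {f f' g g' : EuclideanSpace ℝ (Fin n) → ℂ}
    (h : HasWeakPartialDeriv Ω j f g) (hf : f =ᵐ[volume.restrict Ω] f')
    (hg : g =ᵐ[volume.restrict Ω] g') : HasWeakPartialDeriv Ω j f' g' := by
  refine ⟨h.1.congr hf, h.2.1.congr hg, fun ψ => ?_⟩
  rw [← integral_congr_ae (hf.mono fun x hx => by simp only [hx] :
      (fun x => f x * partialDeriv j ψ x) =ᵐ[volume.restrict Ω] fun x => f' x * partialDeriv j ψ x),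
    ← integral_congr_ae (hg.mono fun x hx => by simp only [hx] :
      (fun x => g x * ψ x) =ᵐ[volume.restrict Ω] fun x => g' x * ψ x)]
  exact h.2.2 ψ

/-! ### Weighted spaces -/

/-- The measure `e^{-φ} dλ` on `Ω`. -/
def weightedMeasure (Ω : Opens (EuclideanSpace ℝ (Fin n))) (φ : EuclideanSpace ℝ (Fin n) → ℝ) :
    Measure (EuclideanSpace ℝ (Fin n)) :=
  (volume.restrict Ω).withDensity fun x => ENNReal.ofReal (Real.exp (-φ x))

/-- The weighted space `L²(Ω, φ)`. -/
abbrev WeightedL2 (Ω : Opens (EuclideanSpace ℝ (Fin n))) (φ : EuclideanSpace ℝ (Fin n) → ℝ) :=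
  Lp ℂ 2 (weightedMeasure Ω φ)

variable {φ : EuclideanSpace ℝ (Fin n) → ℝ}

theorem ae_weighted_iff (hφ : ContDiffOn ℝ ∞ φ Ω) {f g : EuclideanSpace ℝ (Fin n) → ℂ} :
    f =ᵐ[weightedMeasure Ω φ] g ↔ f =ᵐ[volume.restrict Ω] g := by
  have hm : AEMeasurable (fun x => ENNReal.ofReal (Real.exp (-φ x)))
      (volume.restrict (Ω : Set (EuclideanSpace ℝ (Fin n)))) :=
    (Real.measurable_exp.comp_aemeasurable
      (hφ.continuousOn.aemeasurable Ω.isOpen.measurableSet).neg).ennreal_ofReal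
  constructor
  · intro h
    exact (withDensity_absolutelyContinuous' hm
      (Eventually.of_forall fun x => by simp [Real.exp_pos])).ae_le h
  · intro h
    exact (withDensity_absolutelyContinuous _ _).ae_le h

/-- The Sobolev space `H¹(Ω, φ)`, with squared norm `‖f‖² + ∑ⱼ ‖∂f/∂xⱼ‖²` (norms of `L²(Ω, φ)`).
Its elements are written as pairs of a function `f` and its weak gradient, which is determined
by `f`. -/
def sobolevH1 (hφ : ContDiffOn ℝ ∞ φ Ω) :
    Submodule ℂ (WithLp 2 (WeightedL2 Ω φ × PiLp 2 fun _ : Fin n => WeightedL2 Ω φ)) where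
  carrier := {u | ∀ j, HasWeakPartialDeriv Ω j u.fst (u.snd j)}
  zero_mem' := fun j => by
    have h0 : HasWeakPartialDeriv Ω j 0 0 :=
      ⟨locallyIntegrable_zero.locallyIntegrableOn _, locallyIntegrable_zero.locallyIntegrableOn _,
        fun ψ => by simp⟩
    have hz : (0 : EuclideanSpace ℝ (Fin n) → ℂ) =ᵐ[volume.restrict Ω] (0 : WeightedL2 Ω φ) :=
      (ae_weighted_iff hφ).1 (Lp.coeFn_zero ℂ 2 (weightedMeasure Ω φ)).symm
    exact h0.congr hz hz
  add_mem' := fun {u v} hu hv j => ((hu j).add (hv j)).congr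
    ((ae_weighted_iff hφ).1 (Lp.coeFn_add u.fst v.fst).symm)
    ((ae_weighted_iff hφ).1 (Lp.coeFn_add (u.snd j) (v.snd j)).symm)
  smul_mem' := fun c u hu j => ((hu j).smul c).congr
    ((ae_weighted_iff hφ).1 (Lp.coeFn_smul c u.fst).symm)
    ((ae_weighted_iff hφ).1 (Lp.coeFn_smul c (u.snd j)).symm)

/-- The injection `H¹(Ω, φ) ↪ L²(Ω, φ)`. -/
def embeddingH1 (hφ : ContDiffOn ℝ ∞ φ Ω) : sobolevH1 hφ →L[ℂ] WeightedL2 Ω φ :=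
  (WithLp.fstL 2 ℂ _ _).comp (sobolevH1 hφ).subtypeL

/-- The test functions `C₀^∞(Ω)` as a subspace of `H¹(Ω, φ)`. -/
def testSubspace (hφ : ContDiffOn ℝ ∞ φ Ω) : Submodule ℂ (sobolevH1 hφ) where
  carrier := {u | ∃ ψ : 𝓓(Ω, ℂ), embeddingH1 hφ u =ᵐ[weightedMeasure Ω φ] ψ}
  zero_mem' := ⟨0, by rw [map_zero]; exact Lp.coeFn_zero ℂ 2 (weightedMeasure Ω φ)⟩
  add_mem' := by
    rintro u v ⟨ψ, hψ⟩ ⟨χ, hχ⟩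
    exact ⟨ψ + χ, by rw [map_add]; exact (Lp.coeFn_add _ _).trans (hψ.add hχ)⟩
  smul_mem' := by
    rintro c u ⟨ψ, hψ⟩
    exact ⟨c • ψ, by rw [map_smul]; exact (Lp.coeFn_smul _ _).trans (hψ.const_smul c)⟩

/-- The Sobolev space `H¹₀(Ω, φ)`: the closure of `C₀^∞(Ω)` in `H¹(Ω, φ)`. -/
def sobolevH10 (hφ : ContDiffOn ℝ ∞ φ Ω) : Submodule ℂ (sobolevH1 hφ) :=
  (testSubspace hφ).topologicalClosure

/-- The injection `H¹₀(Ω, φ) ↪ L²(Ω, φ)`. -/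
def embeddingH10 (hφ : ContDiffOn ℝ ∞ φ Ω) : sobolevH10 hφ →L[ℂ] WeightedL2 Ω φ :=
  (embeddingH1 hφ).comp (sobolevH10 hφ).subtypeL

/-! ### Schrödinger operators -/

/-- The (unweighted) space `L²(Ω)`. -/
abbrev L2 (Ω : Opens (EuclideanSpace ℝ (Fin n))) :=
  Lp ℂ 2 (volume.restrict (Ω : Set (EuclideanSpace ℝ (Fin n))))

/-- The potential `V₁ = |∇φ|² / 4 - Δφ / 2`. -/
def potential (φ : EuclideanSpace ℝ (Fin n) → ℝ) (x : EuclideanSpace ℝ (Fin n)) : ℝ :=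
  1 / 4 * ‖gradient φ x‖ ^ 2 - 1 / 2 * Δ φ x

/-- The differential expression `-Δψ + Vψ`. -/
def schrodingerExpr (V : EuclideanSpace ℝ (Fin n) → ℝ) (ψ : EuclideanSpace ℝ (Fin n) → ℂ)
    (x : EuclideanSpace ℝ (Fin n)) : ℂ :=
  -Δ ψ x + (V x : ℂ) * ψ x

theorem two_le_infty : (2 : WithTop ℕ∞) ≤ ∞ := ENat.LEInfty.out

theorem contDiff_two_test (ψ : 𝓓(Ω, ℂ)) : ContDiff ℝ 2 ψ :=
  ψ.contDiff.of_le two_le_infty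

theorem schrodingerExpr_add (V : EuclideanSpace ℝ (Fin n) → ℝ) (ψ χ : 𝓓(Ω, ℂ)) :
    schrodingerExpr V (ψ + χ : 𝓓(Ω, ℂ)) = schrodingerExpr V ψ + schrodingerExpr V χ := by
  ext x
  have := ContDiffAt.laplacian_add (x := x) (contDiff_two_test ψ).contDiffAt
    (contDiff_two_test χ).contDiffAt
  simp only [schrodingerExpr, FunLike.coe_add, Pi.add_apply, this]
  ring

theorem schrodingerExpr_smul (V : EuclideanSpace ℝ (Fin n) → ℝ) (c : ℂ) (ψ : 𝓓(Ω, ℂ)) :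
    schrodingerExpr V (c • ψ : 𝓓(Ω, ℂ)) = c • schrodingerExpr V ψ := by
  ext x
  have := InnerProductSpace.laplacian_smul (x := x) c
    (contDiff_two_test ψ).contDiffAt
  simp only [schrodingerExpr, FunLike.coe_smul, Pi.smul_apply, this, smul_eq_mul]
  ring

/-- The graph of `-Δ + V` acting on `C₀^∞(Ω)`. -/
def schrodingerGraph (Ω : Opens (EuclideanSpace ℝ (Fin n))) (V : EuclideanSpace ℝ (Fin n) → ℝ) :
    Submodule ℂ (L2 Ω × L2 Ω) where
  carrier := {p | ∃ ψ : 𝓓(Ω, ℂ), p.1 =ᵐ[volume.restrict Ω] ψ ∧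
    p.2 =ᵐ[volume.restrict Ω] schrodingerExpr V ψ}
  zero_mem' := by
    refine ⟨0, Lp.coeFn_zero _ _ _, (Lp.coeFn_zero _ _ _).trans (Eventually.of_forall fun x => ?_)⟩
    have := congrFun (schrodingerExpr_smul V 0 (0 : 𝓓(Ω, ℂ))) x
    rw [zero_smul, zero_smul] at this
    exact this.symm
  add_mem' := by
    rintro p q ⟨ψ, h1, h2⟩ ⟨χ, h3, h4⟩
    refine ⟨ψ + χ, (Lp.coeFn_add _ _).trans (h1.add h3), ?_⟩
    rw [schrodingerExpr_add]
    exact (Lp.coeFn_add _ _).trans (h2.add h4)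
  smul_mem' := by
    rintro c p ⟨ψ, h1, h2⟩
    refine ⟨c • ψ, (Lp.coeFn_smul _ _).trans (h1.const_smul c), ?_⟩
    rw [schrodingerExpr_smul]
    exact (Lp.coeFn_smul _ _).trans (h2.const_smul c)

/-- The operator `-Δ + V` in `L²(Ω)` with domain `C₀^∞(Ω)`. -/
def schrodingerOperator (Ω : Opens (EuclideanSpace ℝ (Fin n)))
    (V : EuclideanSpace ℝ (Fin n) → ℝ) : L2 Ω →ₗ.[ℂ] L2 Ω :=
  (schrodingerGraph Ω V).toLinearPMap

theorem test_eq_of_ae_eq {ψ χ : 𝓓(Ω, ℂ)}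
    (h : ψ =ᵐ[volume.restrict Ω] χ) : ψ = χ := by
  have h1 : EqOn ψ χ Ω :=
    Measure.eqOn_open_of_ae_eq h Ω.isOpen ψ.continuous.continuousOn χ.continuous.continuousOn
  ext x
  by_cases hx : x ∈ Ω
  · exact h1 hx
  · rw [image_eq_zero_of_notMem_tsupport fun h => hx (ψ.tsupport_subset h),
      image_eq_zero_of_notMem_tsupport fun h => hx (χ.tsupport_subset h)]

theorem schrodingerOperator_graph (V : EuclideanSpace ℝ (Fin n) → ℝ) :
    (schrodingerOperator Ω V).graph = schrodingerGraph Ω V := by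
  refine Submodule.toLinearPMap_graph_eq _ ?_
  rintro ⟨u, w⟩ ⟨ψ, h1, h2⟩ (rfl : u = 0)
  have h : ψ = 0 := test_eq_of_ae_eq (h1.symm.trans (Lp.coeFn_zero _ _ _))
  subst h
  refine Lp.ext (h2.trans (EventuallyEq.trans (Eventually.of_forall fun x => ?_)
    (Lp.coeFn_zero _ _ _).symm))
  have := congrFun (schrodingerExpr_smul V 0 (0 : 𝓓(Ω, ℂ))) x
  rwa [zero_smul, zero_smul] at this

theorem partialDeriv_mul {f g : EuclideanSpace ℝ (Fin n) → ℂ} {x : EuclideanSpace ℝ (Fin n)}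
    (hf : DifferentiableAt ℝ f x) (hg : DifferentiableAt ℝ g x) :
    partialDeriv j (fun y => f y * g y) x =
      f x * partialDeriv j g x + partialDeriv j f x * g x := by
  simp only [partialDeriv]
  rw [fderiv_fun_mul hf hg]
  simp [mul_comm]

theorem partialDeriv_add {f g : EuclideanSpace ℝ (Fin n) → ℂ} {x : EuclideanSpace ℝ (Fin n)}
    (hf : DifferentiableAt ℝ f x) (hg : DifferentiableAt ℝ g x) :
    partialDeriv j (fun y => f y + g y) x = partialDeriv j f x + partialDeriv j g x := by
  simp only [partialDeriv]
  rw [fderiv_fun_add hf hg]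
  simp

theorem partialDeriv_const_mul (c : ℂ) {f : EuclideanSpace ℝ (Fin n) → ℂ}
    {x : EuclideanSpace ℝ (Fin n)} (hf : DifferentiableAt ℝ f x) :
    partialDeriv j (fun y => c * f y) x = c * partialDeriv j f x := by
  rw [partialDeriv_mul (differentiableAt_const _) hf]
  simp [partialDeriv]

theorem partialDeriv_star {f : EuclideanSpace ℝ (Fin n) → ℂ} {x : EuclideanSpace ℝ (Fin n)}
    (hf : DifferentiableAt ℝ f x) :
    partialDeriv j (fun y => (starRingEnd ℂ) (f y)) x = (starRingEnd ℂ) (partialDeriv j f x) := by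
  have h := (Complex.conjCLE.toContinuousLinearMap.hasFDerivAt.comp x hf.hasFDerivAt).fderiv
  simp only [partialDeriv]
  exact congrArg (fun L : EuclideanSpace ℝ (Fin n) →L[ℝ] ℂ => L (EuclideanSpace.single j 1)) h

theorem partialDeriv_ofReal {f : EuclideanSpace ℝ (Fin n) → ℝ} {x : EuclideanSpace ℝ (Fin n)}
    (hf : DifferentiableAt ℝ f x) :
    partialDeriv j (fun y => (f y : ℂ)) x = ((partialDeriv j f x : ℝ) : ℂ) := by
  have h := (Complex.ofRealCLM.hasFDerivAt.comp x hf.hasFDerivAt).fderiv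
  simp only [partialDeriv]
  exact congrArg (fun L : EuclideanSpace ℝ (Fin n) →L[ℝ] ℂ => L (EuclideanSpace.single j 1)) h

theorem laplacian_eq_sum {F : Type*} [NormedAddCommGroup F] [NormedSpace ℝ F]
    {f : EuclideanSpace ℝ (Fin n) → F} {x : EuclideanSpace ℝ (Fin n)} (hf : ContDiffAt ℝ 2 f x) :
    Δ f x = ∑ j, partialDeriv j (partialDeriv j f) x := by
  rw [InnerProductSpace.laplacian_eq_iteratedFDeriv_orthonormalBasis f
    (EuclideanSpace.basisFun (Fin n) ℝ)]
  refine Finset.sum_congr rfl fun j _ => ?_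
  have h : DifferentiableAt ℝ (fderiv ℝ f) x :=
    (hf.fderiv_right (m := 1) (by norm_num)).differentiableAt (by norm_num)
  rw [iteratedFDeriv_two_apply]
  have e : fderiv ℝ (partialDeriv j f) x =
      fderiv ℝ (fun y => fderiv ℝ f y (EuclideanSpace.single j 1)) x := rfl
  rw [partialDeriv, e, fderiv_clm_apply h (differentiableAt_const _)]
  simp

theorem norm_gradient_sq (f : EuclideanSpace ℝ (Fin n) → ℝ) (x : EuclideanSpace ℝ (Fin n)) :
    ‖gradient f x‖ ^ 2 = ∑ j, partialDeriv j f x ^ 2 := by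
  rw [EuclideanSpace.norm_sq_eq]
  refine Finset.sum_congr rfl fun j _ => ?_
  have : gradient f x j = partialDeriv j f x := by
    have h : ⟪gradient f x, EuclideanSpace.single j (1 : ℝ)⟫_ℝ = partialDeriv j f x := by
      simp [gradient, partialDeriv]
    rw [← h, EuclideanSpace.inner_single_right]
    simp
  rw [this, Real.norm_eq_abs, sq_abs]

theorem contDiff_mul_test {h : EuclideanSpace ℝ (Fin n) → ℂ} {m : WithTop ℕ∞}
    (hh : ∀ x ∈ Ω, ContDiffAt ℝ m h x) {χ : EuclideanSpace ℝ (Fin n) → ℂ}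
    (hχ : ContDiff ℝ m χ) (hs : tsupport χ ⊆ Ω) : ContDiff ℝ m fun x => h x * χ x :=
  contDiff_iff_contDiffAt.2 fun x => by
    by_cases hx : x ∈ tsupport χ
    · exact (hh x (hs hx)).mul hχ.contDiffAt
    · refine (contDiffAt_const (c := (0 : ℂ))).congr_of_eventuallyEq ?_
      filter_upwards [notMem_tsupport_iff_eventuallyEq.1 hx] with y hy
      simp [hy]

theorem integral_partialDeriv_eq_zero {F : EuclideanSpace ℝ (Fin n) → ℂ} (hF : ContDiff ℝ 1 F)
    (hc : HasCompactSupport F) : ∫ x, partialDeriv j F x = 0 := by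
  have hi : Integrable (partialDeriv j F) :=
    ((hF.continuous_fderiv (by norm_num)).clm_apply
      continuous_const).integrable_of_hasCompactSupport (hc.fderiv_apply ℝ _)
  have := integral_mul_fderiv_eq_neg_fderiv_mul_of_integrable (μ := volume)
    (f := fun _ : EuclideanSpace ℝ (Fin n) => (1 : ℂ)) (g := F) (v := EuclideanSpace.single j 1)
    (by simp) (by simpa using! hi) (by simpa using hF.continuous.integrable_of_hasCompactSupport hc)
    (fun x _ => differentiableAt_const _)
    (fun x _ => (hF.differentiable (by norm_num)).differentiableAt)
  simpa [partialDeriv] using this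

set_option maxHeartbeats 1000000 in
theorem isNonnegOperator_schrodinger (hφ : ContDiffOn ℝ ∞ φ Ω) :
    IsNonnegOperator (schrodingerOperator Ω (potential φ)) := by
  intro u
  have hu : ((u : L2 Ω), schrodingerOperator Ω (potential φ) u) ∈
      schrodingerGraph Ω (potential φ) := by
    rw [← schrodingerOperator_graph]
    exact LinearPMap.mem_graph _ u
  obtain ⟨ψ, h1, h2⟩ := hu
  have hφx : ∀ x ∈ Ω, ContDiffAt ℝ ∞ φ x := fun x hx => hφ.contDiffAt (Ω.isOpen.mem_nhds hx)
  have hφj : ∀ j : Fin n, ∀ x ∈ Ω, ContDiffAt ℝ 1 (partialDeriv j φ) x := fun j x hx =>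
    (ContDiffAt.fderiv_right (m := 1) ((hφx x hx).of_le two_le_infty)
      (by norm_num)).clm_apply contDiffAt_const
  have hφc : ∀ j : Fin n, ∀ x ∈ Ω, ContDiffAt ℝ 1 (fun y => ((partialDeriv j φ y : ℝ) : ℂ)) x :=
    fun j x hx => Complex.ofRealCLM.contDiff.contDiffAt.comp x (hφj j x hx)
  have hψj : ∀ j : Fin n, ContDiff ℝ 1 (partialDeriv j ψ) := fun j =>
    ((contDiff_two_test ψ).fderiv_right (m := 1) (by norm_num)).clm_apply contDiff_const
  have hψ1 : ContDiff ℝ 1 ψ := (contDiff_two_test ψ).of_le (by norm_num)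
  have hψd : Differentiable ℝ ψ := hψ1.differentiable (by norm_num)
  have hψs : ContDiff ℝ 1 (fun x => (starRingEnd ℂ) (ψ x)) :=
    Complex.conjCLE.contDiff.comp hψ1
  have ha : ∀ j : Fin n, ContDiff ℝ 1 fun x => ((partialDeriv j φ x : ℝ) : ℂ) * ψ x := fun j =>
    contDiff_mul_test (hφc j) hψ1 ψ.tsupport_subset
  set G : Fin n → EuclideanSpace ℝ (Fin n) → ℂ := fun j x =>
    partialDeriv j ψ x + (1 / 2 : ℂ) * (((partialDeriv j φ x : ℝ) : ℂ) * ψ x) with hGdef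
  set F : Fin n → EuclideanSpace ℝ (Fin n) → ℂ := fun j x =>
    (starRingEnd ℂ) (ψ x) * G j x with hFdef
  have hG : ∀ j, ContDiff ℝ 1 (G j) := fun j => (hψj j).add (contDiff_const.mul (ha j))
  have hF : ∀ j, ContDiff ℝ 1 (F j) := fun j => hψs.mul (hG j)
  have hGs : ∀ j, Function.support (G j) ⊆ tsupport ψ := by
    intro j x hx
    by_contra hx'
    refine hx ?_
    have e1 : partialDeriv j ψ x = 0 := by
      by_contra h
      exact hx' (support_partialDeriv_subset ψ h)
    simp [hGdef, e1, image_eq_zero_of_notMem_tsupport hx']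
  have hFs : ∀ j, Function.support (F j) ⊆ tsupport ψ := fun j =>
    (Function.support_mul_subset_right _ _).trans (hGs j)
  have hFc : ∀ j, HasCompactSupport (F j) := fun j =>
    ψ.hasCompactSupport.mono' (hFs j)
  have hGc : ∀ j, HasCompactSupport (G j) := fun j =>
    ψ.hasCompactSupport.mono' (hGs j)
  have hGi : ∀ j, Integrable fun x => ((‖G j x‖ ^ 2 : ℝ) : ℂ) := by
    intro j
    have hi : Integrable (fun x => ‖G j x‖ ^ 2) volume :=
      Continuous.integrable_of_hasCompactSupport ((hG j).continuous.norm.pow 2)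
        ((hGc j).mono fun x hx h => hx (show ‖G j x‖ ^ 2 = 0 by simp [h]))
    exact hi.ofReal
  have hFi : ∀ j, Integrable (partialDeriv j (F j)) := fun j =>
    (((hF j).continuous_fderiv (by norm_num)).clm_apply
      continuous_const).integrable_of_hasCompactSupport ((hFc j).fderiv_apply ℝ _)
  have hF0 : ∀ j, ∫ x in Ω, partialDeriv j (F j) x = 0 := by
    intro j
    rw [setIntegral_eq_integral_of_forall_compl_eq_zero,
      integral_partialDeriv_eq_zero (hF j) (hFc j)]
    intro x hx
    have hx' : x ∉ tsupport (F j) := fun h =>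
      hx (ψ.tsupport_subset (closure_minimal (hFs j) (isClosed_tsupport _) h))
    have h0 : fderiv ℝ (F j) x = 0 := by
      by_contra h
      exact hx' (support_fderiv_subset ℝ h)
    simp [partialDeriv, h0]
  have key : ∀ x ∈ Ω, schrodingerExpr (potential φ) ψ x * (starRingEnd ℂ) (ψ x) =
      ∑ j, (((‖G j x‖ ^ 2 : ℝ) : ℂ) - partialDeriv j (F j) x) := by
    intro x hx
    have eΔ : Δ φ x = ∑ j, partialDeriv j (partialDeriv j φ) x :=
      laplacian_eq_sum ((hφx x hx).of_le two_le_infty)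
    simp only [schrodingerExpr, potential, norm_gradient_sq, eΔ,
      laplacian_eq_sum (contDiff_two_test ψ).contDiffAt]
    push_cast
    simp only [Finset.mul_sum, ← Finset.sum_neg_distrib, ← Finset.sum_sub_distrib, Finset.sum_mul,
      ← Finset.sum_add_distrib]
    refine Finset.sum_congr rfl fun j _ => ?_
    have hdj : DifferentiableAt ℝ (partialDeriv j φ) x :=
      (hφj j x hx).differentiableAt (by norm_num)
    have hdc : DifferentiableAt ℝ (fun y => ((partialDeriv j φ y : ℝ) : ℂ)) x :=
      (hφc j x hx).differentiableAt (by norm_num)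
    have e1 : partialDeriv j (F j) x = (starRingEnd ℂ) (ψ x) * partialDeriv j (G j) x +
        (starRingEnd ℂ) (partialDeriv j ψ x) * G j x := by
      rw [hFdef, partialDeriv_mul ((hψs.differentiable (by norm_num)) x)
        (((hG j).differentiable (by norm_num)) x), partialDeriv_star (hψd x)]
    have e2 : partialDeriv j (G j) x = partialDeriv j (partialDeriv j ψ) x +
        (1 / 2 : ℂ) * (((partialDeriv j φ x : ℝ) : ℂ) * partialDeriv j ψ x +
          ((partialDeriv j (partialDeriv j φ) x : ℝ) : ℂ) * ψ x) := by
      have da : DifferentiableAt ℝ (fun x => ((partialDeriv j φ x : ℝ) : ℂ) * ψ x) x :=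
        (ha j).differentiable (by norm_num) x
      have dp : DifferentiableAt ℝ (partialDeriv j ψ) x :=
        (hψj j).differentiable (by norm_num) x
      rw [hGdef, partialDeriv_add dp (da.const_mul _), partialDeriv_const_mul _ da,
        partialDeriv_mul hdc (hψd x), partialDeriv_ofReal hdj]
    have e3 : ((‖G j x‖ : ℂ)) ^ 2 = G j x * ((starRingEnd ℂ) (partialDeriv j ψ x) +
        (1 / 2 : ℂ) * (((partialDeriv j φ x : ℝ) : ℂ) * (starRingEnd ℂ) (ψ x))) := by
      rw [← Complex.mul_conj']
      simp only [hGdef, map_add, map_mul, Complex.conj_ofReal, map_div₀, map_one, map_ofNat]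
    rw [e3, e1, e2]
    simp only [hGdef]
    ring
  refine ⟨∑ j, ∫ x in Ω, ‖G j x‖ ^ 2,
    Finset.sum_nonneg fun j _ => integral_nonneg fun x => by positivity, ?_⟩
  rw [MeasureTheory.L2.inner_def]
  have hcong : (fun x => ⟪(u : L2 Ω) x, schrodingerOperator Ω (potential φ) u x⟫_ℂ)
      =ᵐ[volume.restrict (Ω : Set (EuclideanSpace ℝ (Fin n)))]
      fun x => ∑ j, (((‖G j x‖ ^ 2 : ℝ) : ℂ) - partialDeriv j (F j) x) := by
    filter_upwards [h1, h2, ae_restrict_mem Ω.isOpen.measurableSet] with x hx1 hx2 hx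
    rw [← key x hx, hx1, hx2]
    rfl
  rw [integral_congr_ae hcong, integral_finsetSum]
  swap
  · exact fun j _ => ((hGi j).sub (hFi j)).integrableOn
  rw [Complex.ofReal_sum]
  refine Finset.sum_congr rfl fun j _ => ?_
  refine (integral_sub (hGi j).integrableOn (hFi j).integrableOn).trans ?_
  rw [hF0 j, sub_zero]
  exact integral_ofReal

/-- The Dirichlet realization of `-Δ + V₁` in `L²(Ω)`: the Friedrichs extension of
`-Δ + V₁` on `C₀^∞(Ω)`. -/
def dirichletRealization (hφ : ContDiffOn ℝ ∞ φ Ω) : L2 Ω →ₗ.[ℂ] L2 Ω :=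
  friedrichsExtension (schrodingerOperator Ω (potential φ)) (isNonnegOperator_schrodinger hφ)

/-- `g = e^{-φ/2} ∇(e^{φ/2} u) = ∇u + u ∇φ / 2` on `Ω` in the sense of distributions. -/
def HasWittenGradient (φ : EuclideanSpace ℝ (Fin n) → ℝ) (u : L2 Ω) (g : Fin n → L2 Ω) : Prop :=
  ∀ j, HasWeakPartialDeriv Ω j u
    (fun x => g j x - (1 / 2 : ℂ) * ((partialDeriv j φ x : ℝ) : ℂ) * u x)

theorem HasWittenGradient.add {u v : L2 Ω} {g h : Fin n → L2 Ω}
    (hu : HasWittenGradient φ u g) (hv : HasWittenGradient φ v h) :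
    HasWittenGradient φ (u + v) (g + h) := fun j => by
  refine ((hu j).add (hv j)).congr (Lp.coeFn_add u v).symm ?_
  filter_upwards [Lp.coeFn_add u v, Lp.coeFn_add (g j) (h j)] with x h1 h2
  simp only [Pi.add_apply] at h1 h2 ⊢
  rw [h1, h2]
  ring

theorem HasWittenGradient.smul (c : ℂ) {u : L2 Ω} {g : Fin n → L2 Ω}
    (hu : HasWittenGradient φ u g) : HasWittenGradient φ (c • u) (c • g) := fun j => by
  refine ((hu j).smul c).congr (Lp.coeFn_smul c u).symm ?_
  filter_upwards [Lp.coeFn_smul c u, Lp.coeFn_smul c (g j)] with x h1 h2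
  simp only [Pi.smul_apply, smul_eq_mul] at h1 h2 ⊢
  rw [h1, h2]
  ring

theorem hasWittenGradient_zero : HasWittenGradient φ (0 : L2 Ω) 0 := fun j => by
  have h0 : HasWeakPartialDeriv Ω j 0 0 :=
    ⟨locallyIntegrable_zero.locallyIntegrableOn _, locallyIntegrable_zero.locallyIntegrableOn _,
      fun ψ => by simp⟩
  refine h0.congr (Lp.coeFn_zero _ _ _).symm ?_
  filter_upwards [Lp.coeFn_zero ℂ 2 (volume.restrict (Ω : Set (EuclideanSpace ℝ (Fin n))))]
    with x h1
  simp only [Pi.zero_apply, h1]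
  simp

/-- The domain of the Neumann realization of `-Δ + V₁`: the functions `u` in the domain of the
maximal operator `-Δ + V₁` (the adjoint of `-Δ + V₁` on `C₀^∞(Ω)`) that lie in the domain of
the maximal form `q(u, v) = ∫ (∇u + u∇φ/2) · conj (∇v + v∇φ/2)` and satisfy the natural boundary
condition, i.e. Green's formula `q(u, v) = ∫ (-Δu + V₁u) conj v` for every `v` in that form
domain. -/
def neumannDomain (Ω : Opens (EuclideanSpace ℝ (Fin n))) (φ : EuclideanSpace ℝ (Fin n) → ℝ) :
    Submodule ℂ (L2 Ω) where
  carrier := {u | ∃ w : L2 Ω, ((u, w) ∈ ((schrodingerOperator Ω (potential φ))†).graph) ∧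
    ∃ g : Fin n → L2 Ω, HasWittenGradient φ u g ∧
      ∀ (v : L2 Ω) (h : Fin n → L2 Ω), HasWittenGradient φ v h →
        ∑ j, ⟪h j, g j⟫_ℂ = ⟪v, w⟫_ℂ}
  zero_mem' := ⟨0, Submodule.zero_mem _, 0, hasWittenGradient_zero, by simp⟩
  add_mem' := by
    rintro u u' ⟨w, hw, g, hg, hq⟩ ⟨w', hw', g', hg', hq'⟩
    refine ⟨w + w', Submodule.add_mem _ hw hw', g + g', hg.add hg', fun v h hv => ?_⟩
    simp only [Pi.add_apply, inner_add_right, Finset.sum_add_distrib, hq v h hv, hq' v h hv]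
  smul_mem' := by
    rintro c u ⟨w, hw, g, hg, hq⟩
    refine ⟨c • w, Submodule.smul_mem _ c hw, c • g, hg.smul c, fun v h hv => ?_⟩
    simp only [Pi.smul_apply, inner_smul_right, ← Finset.mul_sum, hq v h hv]

/-- The Neumann realization of `-Δ + V₁` in `L²(Ω)`. -/
def neumannRealization (Ω : Opens (EuclideanSpace ℝ (Fin n)))
    (φ : EuclideanSpace ℝ (Fin n) → ℝ) : L2 Ω →ₗ.[ℂ] L2 Ω :=
  ((schrodingerOperator Ω (potential φ))†).domRestrict (neumannDomain Ω φ)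

end WeightedSobolev

end

/-! Multiplication by e^{-φ/2} is a unitary map from L²(Ω, φ) onto L²(Ω) that carries ∂_j to D_j =
∂_j + (∂_jφ)/2. With D_j* = -∂_j + (∂_jφ)/2, the formal adjoint, -Δ + V₁ = ∑ D_j* D_j
(`schrodingerExpr_eq_sum`), so the H¹(Ω, φ) inner product becomes ⟪u, v⟫ + q(u, v). Let J be the
injection of H¹ or H¹₀ followed by this unitary map.

An operator A comes from the form on V exactly when Au = y means u = Jw with ⟪v, w⟫ = ⟪Jv, y + u⟫
for all v, that is, w = J*(y + u). Hence (A + 1)⁻¹ = JJ* (`IsFormOperator.isResolventAt`).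
Compactness of JJ* is equivalent to compactness of J (`isCompactOperator_comp_adjoint_iff`), and by
the resolvent identity it does not matter at which z the resolvent is compact.

It remains to see that both realizations are such form operators. For Neumann, V = H¹ and the
condition on w is Green's formula (`isFormOperator_neumannRealization`). For Dirichlet, V = H¹₀, in
which test functions are dense; the form domain of the Friedrichs extension is then J(V), and the
adjoint relation extends from test functions to V by continuity
(`isFormOperator_friedrichsExtension`). -/

noncomputable section

namespace WeightedSobolev

/-! ### Compactness of T T* and independence of the spectral point -/

section AbstractOperators

variable {H V : Type*} [NormedAddCommGroup H] [InnerProductSpace ℂ H] [CompleteSpace H]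
  [NormedAddCommGroup V] [InnerProductSpace ℂ V] [CompleteSpace V]

-- Since ‖T*x‖² = ⟪x, TT*x⟫ ≤ ‖x‖ ‖TT*x‖, a finite net for the image of the unit ball under TT*
-- yields one for its image under T*.
open ContinuousLinearMap in
theorem isCompactOperator_adjoint_of_comp_adjoint (T : V →L[ℂ] H)
    (h : IsCompactOperator (T ∘L adjoint T)) : IsCompactOperator (adjoint T) := by
  have hK : TotallyBounded ((T ∘L adjoint T) '' Metric.closedBall 0 1) :=
    (IsCompactOperator.isCompact_closure_image_closedBall
      (f := (T ∘L adjoint T : H →ₗ[ℂ] H)) h 1).totallyBounded.subset subset_closure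
  refine (isCompactOperator_iff_isCompact_closure_image_closedBall
    (adjoint T : H →ₗ[ℂ] V) one_pos).2 ?_
  refine TotallyBounded.isCompact_of_isClosed (TotallyBounded.closure ?_) isClosed_closure
  refine Metric.totallyBounded_iff.2 fun ε hε => ?_
  -- Two points of the unit ball differ by at most 2 in norm, so radius ε²/2 gives ‖T*(x - a)‖² <
  -- ε². The centres are taken inside the image so that they have preimages `a` in the ball.
  obtain ⟨t, ht, htf, hcov⟩ := Metric.finite_approx_of_totallyBounded hK (ε ^ 2 / 2) (by positivity)
  obtain ⟨s, hs, hsf, rfl⟩ :=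
    (Set.exists_subset_image_finite_and (p := fun u => u = t)).1 ⟨t, ht, htf, rfl⟩
  refine ⟨adjoint T '' s, hsf.image _, ?_⟩
  rintro _ ⟨x, hx, rfl⟩
  have hx' := hcov ⟨x, hx, rfl⟩
  simp only [mem_iUnion, exists_prop, mem_image, exists_exists_and_eq_and, Metric.mem_ball,
    dist_eq_norm, coe_coe] at hx' ⊢
  obtain ⟨a, ha, hax⟩ := hx'
  refine ⟨a, ha, ?_⟩
  rw [← map_sub] at hax ⊢
  have h1 : ‖x - a‖ ≤ 2 := by
    have := norm_sub_le x a
    have := mem_closedBall_zero_iff.1 hx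
    have := mem_closedBall_zero_iff.1 (hs ha)
    linarith
  have h2 : ‖adjoint T (x - a)‖ ^ 2 ≤ ‖x - a‖ * ‖(T ∘L adjoint T) (x - a)‖ := by
    have e : ⟪x - a, (T ∘L adjoint T) (x - a)⟫_ℂ = ((‖adjoint T (x - a)‖ ^ 2 : ℝ) : ℂ) := by
      rw [comp_apply, ← adjoint_inner_left, inner_self_eq_norm_sq_to_K]
      simp
    have := norm_inner_le_norm (𝕜 := ℂ) (x - a) ((T ∘L adjoint T) (x - a))
    rwa [e, Complex.norm_real, Real.norm_of_nonneg (by positivity)] at this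
  refine lt_of_pow_lt_pow_left₀ 2 hε.le ?_
  nlinarith [norm_nonneg ((T ∘L adjoint T) (x - a))]

-- For the nontrivial direction the previous lemma is used twice: TT* compact gives T* compact,
-- hence T*T compact, hence T = (T*)* compact.
open ContinuousLinearMap in
theorem isCompactOperator_comp_adjoint_iff (T : V →L[ℂ] H) :
    IsCompactOperator (T ∘L adjoint T) ↔ IsCompactOperator T := by
  refine ⟨fun h => ?_, fun h => h.comp_clm (adjoint T)⟩
  have h1 := (isCompactOperator_adjoint_of_comp_adjoint T h).comp_clm T
  have h2 := isCompactOperator_adjoint_of_comp_adjoint (adjoint T)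
    (by rw [adjoint_adjoint]; exact h1)
  rwa [adjoint_adjoint] at h2

-- By the resolvent identity R = R' + (z - z') R R', compactness of one resolvent forces compactness
-- of any other.
omit [CompleteSpace H] in
theorem IsResolventAt.hasCompactResolvent_iff {A : H →ₗ.[ℂ] H} {z : ℂ} {R : H →L[ℂ] H}
    (hR : IsResolventAt A z R) : HasCompactResolvent A ↔ IsCompactOperator R := by
  refine ⟨?_, fun h => ⟨z, R, hR, h⟩⟩
  rintro ⟨z', R', hR', hc⟩
  have e : R = R' + (z - z') • (R ∘L R') := by
    ext y
    obtain ⟨x, hx, hy⟩ := hR'.2 y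
    have h1 := hR.1 x
    have h2 : A x - z • (x : H) = y - (z - z') • (x : H) := by
      rw [← hy, sub_smul]
      abel
    rw [h2, map_sub, map_smul, sub_eq_iff_eq_add, hx] at h1
    simpa using h1
  rw [e]
  exact hc.add ((hc.clm_comp R).smul (z - z'))

/-! ### Form operators and their resolvent at -1 -/

/-- `A` is the operator of the form `⟪v, w⟫ - ⟪J v, J w⟫` on `V`, transported to `H` along `J`. -/
def IsFormOperator (A : H →ₗ.[ℂ] H) (J : V →L[ℂ] H) : Prop :=
  ∀ u y : H, (u, y) ∈ A.graph ↔ ∃ w : V, J w = u ∧ ∀ v : V, ⟪v, w⟫_ℂ = ⟪J v, y + u⟫_ℂ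

-- The defining relation says w = J*(y + u), so u = Jw = JJ*(Au + u). Conversely w = J*y solves (A +
-- 1)Jw = y.
open ContinuousLinearMap in
theorem IsFormOperator.isResolventAt {A : H →ₗ.[ℂ] H} {J : V →L[ℂ] H} (h : IsFormOperator A J) :
    IsResolventAt A (-1) (J ∘L adjoint J) := by
  refine ⟨fun x => ?_, fun y => ?_⟩
  · obtain ⟨w, hw, hv⟩ := (h x (A x)).1 (LinearPMap.mem_graph _ x)
    have e : w = adjoint J (A x + x) := ext_inner_left ℂ fun v => by
      rw [hv, adjoint_inner_right]
    rw [neg_one_smul, sub_neg_eq_add, comp_apply, ← e, hw]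
  · have hg := (h (J (adjoint J y)) (y - J (adjoint J y))).2
      ⟨adjoint J y, rfl, fun v => by rw [adjoint_inner_right, sub_add_cancel]⟩
    obtain ⟨x, hx, hx'⟩ := (LinearPMap.mem_graph_iff A).1 hg
    refine ⟨x, hx, ?_⟩
    simp only at hx hx'
    rw [hx', hx, neg_one_smul, sub_neg_eq_add, sub_add_cancel]

theorem IsFormOperator.hasCompactResolvent_iff {A : H →ₗ.[ℂ] H} {J : V →L[ℂ] H}
    (h : IsFormOperator A J) : HasCompactResolvent A ↔ IsCompactOperator J :=
  h.isResolventAt.hasCompactResolvent_iff.trans (isCompactOperator_comp_adjoint_iff J)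

omit [CompleteSpace H] in
theorem mem_graph_domRestrict_iff (A : H →ₗ.[ℂ] H) (D : Submodule ℂ H) (u y : H) :
    (u, y) ∈ (A.domRestrict D).graph ↔ u ∈ D ∧ (u, y) ∈ A.graph := by
  simp only [LinearPMap.mem_graph_iff]
  constructor
  · rintro ⟨⟨x, hx⟩, rfl, hy⟩
    exact ⟨hx.1, ⟨x, hx.2⟩, rfl, (LinearPMap.domRestrict_apply rfl).symm.trans hy⟩
  · rintro ⟨hu, ⟨x, hx⟩, rfl, hy⟩
    exact ⟨⟨x, hu, hx⟩, rfl, (LinearPMap.domRestrict_apply rfl).trans hy⟩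

theorem mem_graph_adjoint_iff {S : H →ₗ.[ℂ] H} (hS : Dense (S.domain : Set H)) (u y : H) :
    (u, y) ∈ (S†).graph ↔ ∀ x : S.domain, ⟪S x, u⟫_ℂ = ⟪(x : H), y⟫_ℂ := by
  rw [LinearPMap.adjoint_graph_eq_graph_adjoint hS, Submodule.mem_adjoint_iff]
  simp only [sub_eq_zero]
  constructor
  · exact fun h x => h _ _ (LinearPMap.mem_graph S x)
  · intro h a b hab
    obtain ⟨x, rfl, rfl⟩ := (LinearPMap.mem_graph_iff S).1 hab
    exact h x

/-! ### The Friedrichs extension as a form operator with core T -/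

variable {S : H →ₗ.[ℂ] H} {hS : IsNonnegOperator S} {J : V →L[ℂ] H} {T : Submodule ℂ V}

-- Taking v = t in `hTS` gives ‖t‖² = ‖x‖² + ⟪x, Sx⟫. On the core, the norm of V is thus the form
-- norm.
omit [CompleteSpace H] [CompleteSpace V] in
theorem norm_sq_eq_of_isCore
    (hTS : ∀ t ∈ T, ∀ x : S.domain, J t = x → ∀ v, ⟪t, v⟫_ℂ = ⟪(x : H) + S x, J v⟫_ℂ)
    (hS : IsNonnegOperator S) {t : V} (ht : t ∈ T) {x : S.domain} (hx : J t = x) :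
    ‖⟪(x : H), S x⟫_ℂ‖ = ‖t‖ ^ 2 - ‖(x : H)‖ ^ 2 := by
  have h := hTS t ht x hx t
  obtain ⟨r, hr, er⟩ := hS x
  have er' : ⟪S x, (x : H)⟫_ℂ = (r : ℂ) := by
    rw [← inner_conj_symm, er, Complex.conj_ofReal]
  rw [hx, inner_add_left, inner_self_eq_norm_sq_to_K, inner_self_eq_norm_sq_to_K, er'] at h
  rw [er, Complex.norm_real, Real.norm_of_nonneg hr]
  have h' : ‖t‖ ^ 2 = ‖(x : H)‖ ^ 2 + r := by
    apply Complex.ofReal_injective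
    push_cast
    exact h
  linarith

-- A sequence in the domain of S that converges in H and is Cauchy for the form is a Cauchy sequence
-- of V, so it has a limit w in V, and Jw is its limit in H. Conversely, approximate w from T.
omit [CompleteSpace H] in
theorem mem_formDomain_iff_of_isCore (hT : Dense (T : Set V))
    (hST : ∀ x : S.domain, ∃ t ∈ T, J t = x) (hTx : ∀ t ∈ T, J t ∈ S.domain)
    (hTS : ∀ t ∈ T, ∀ x : S.domain, J t = x → ∀ v, ⟪t, v⟫_ℂ = ⟪(x : H) + S x, J v⟫_ℂ) (u : H) :
    u ∈ formDomain S hS ↔ ∃ w, J w = u := by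
  constructor
  · rintro ⟨x, hx, hx'⟩
    choose t htT htx using fun k => hST (x k)
    have hc : CauchySeq t := by
      rw [cauchySeq_iff_tendsto_dist_atTop_0]
      have h1 : Tendsto (fun p : ℕ × ℕ => ((x p.1 : H) - x p.2)) atTop (𝓝 0) := by
        rw [← prod_atTop_atTop_eq]
        simpa using (hx.comp tendsto_fst).sub (hx.comp tendsto_snd)
      -- The distance in V is the square root of the form value plus the squared distance in H.
      have h2 := (hx'.norm.add (h1.norm.pow 2)).sqrt
      simp only [norm_zero, ne_eq, OfNat.ofNat_ne_zero, not_false_eq_true, zero_pow, add_zero,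
        Real.sqrt_zero] at h2
      refine h2.congr fun p => ?_
      rw [norm_sq_eq_of_isCore hTS hS (T.sub_mem (htT p.1) (htT p.2)) (x := x p.1 - x p.2)
        (by simp [htx]), Submodule.coe_sub, sub_add_cancel, Real.sqrt_sq (norm_nonneg _),
        dist_eq_norm]
    obtain ⟨w, hw⟩ := cauchySeq_tendsto_of_complete hc
    refine ⟨w, tendsto_nhds_unique ((J.continuous.tendsto w).comp hw) ?_⟩
    exact hx.congr fun k => (htx k).symm
  · rintro ⟨w, rfl⟩
    obtain ⟨t, htT, ht⟩ := mem_closure_iff_seq_limit.1 (hT w)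
    refine ⟨fun k => ⟨J (t k), hTx _ (htT k)⟩, (J.continuous.tendsto w).comp ht, ?_⟩
    have h0 : Tendsto (fun p : ℕ × ℕ => t p.1 - t p.2) atTop (𝓝 0) := by
      rw [← prod_atTop_atTop_eq]
      simpa using (ht.comp tendsto_fst).sub (ht.comp tendsto_snd)
    have h1 : Tendsto (fun p : ℕ × ℕ => ‖t p.1 - t p.2‖ ^ 2) atTop (𝓝 0) := by
      simpa using h0.norm.pow 2
    refine squeeze_zero_norm (fun p => ?_) h1
    rw [norm_sq_eq_of_isCore hTS hS (T.sub_mem (htT p.1) (htT p.2)) (by simp)]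
    exact sub_le_self _ (by positivity)

theorem isFormOperator_friedrichsExtension (hd : Dense (S.domain : Set H))
    (hT : Dense (T : Set V))
    (hST : ∀ x : S.domain, ∃ t ∈ T, J t = x) (hTx : ∀ t ∈ T, J t ∈ S.domain)
    (hTS : ∀ t ∈ T, ∀ x : S.domain, J t = x → ∀ v, ⟪t, v⟫_ℂ = ⟪(x : H) + S x, J v⟫_ℂ) :
    IsFormOperator (friedrichsExtension S hS) J := by
  intro u y
  rw [friedrichsExtension, mem_graph_domRestrict_iff, mem_graph_adjoint_iff hd,
    mem_formDomain_iff_of_isCore hT hST hTx hTS]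
  constructor
  · rintro ⟨⟨w, rfl⟩, h⟩
    refine ⟨w, rfl, fun v => ?_⟩
    -- Both sides are continuous in v, so it is enough to compare them on T, where `hTS` brings in S
    -- and the adjoint relation moves it across.
    refine congrFun (Continuous.ext_on hT (f := fun v => ⟪v, w⟫_ℂ)
      (g := fun v => ⟪J v, y + J w⟫_ℂ) (by fun_prop) (by fun_prop) fun t ht => ?_) v
    beta_reduce
    have e := hTS t ht ⟨J t, hTx t ht⟩ rfl w
    rw [e, inner_add_left, h, inner_add_right, add_comm]
  · rintro ⟨w, rfl, h⟩
    refine ⟨⟨w, rfl⟩, fun x => ?_⟩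
    obtain ⟨t, ht, htx⟩ := hST x
    have e := hTS t ht x htx w
    rw [h, htx, inner_add_left, inner_add_right, add_comm] at e
    exact (add_left_cancel e).symm

/-- T need not be dense in V: its closure K is a Hilbert space in its own right, and the form
operator result applies to J restricted to K. -/
theorem friedrichsExtension_hasCompactResolvent_iff (hd : Dense (S.domain : Set H))
    (hST : ∀ x : S.domain, ∃ t ∈ T, J t = x) (hTx : ∀ t ∈ T, J t ∈ S.domain)
    (hTS : ∀ t ∈ T, ∀ x : S.domain, J t = x → ∀ v, ⟪t, v⟫_ℂ = ⟪(x : H) + S x, J v⟫_ℂ)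
    (K : Submodule ℂ V) (hK : (K : Set V) = closure T) :
    HasCompactResolvent (friedrichsExtension S hS) ↔
      IsCompactOperator fun w : K => J w := by
  have hTK : T ≤ K := fun t ht => SetLike.mem_coe.1 (hK ▸ subset_closure ht)
  have : CompleteSpace K := IsClosed.completeSpace_coe (hs := hK ▸ isClosed_closure)
  refine (isFormOperator_friedrichsExtension (J := J ∘L K.subtypeL) (T := T.comap K.subtype)
    hd ?_ ?_ ?_ ?_).hasCompactResolvent_iff
  · intro w
    rw [Topology.IsInducing.subtypeVal.closure_eq_preimage_closure_image]
    refine closure_mono (fun t ht => ?_) (hK ▸ w.2 : (w : V) ∈ closure (T : Set V))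
    exact ⟨⟨t, hTK ht⟩, ht, rfl⟩
  · intro x
    obtain ⟨t, ht, hx⟩ := hST x
    exact ⟨⟨t, hTK ht⟩, ht, hx⟩
  · exact fun t ht => hTx t ht
  · exact fun t ht x hx v => hTS t ht x hx v

end AbstractOperators

variable {n : ℕ} {Ω : Opens (EuclideanSpace ℝ (Fin n))} {j : Fin n}
  {φ : EuclideanSpace ℝ (Fin n) → ℝ}

/-! ### Test functions and the Witten derivatives -/

/-- The product of a test function with a function that is smooth on `Ω`. -/
def testMul (h : EuclideanSpace ℝ (Fin n) → ℂ) (hh : ContDiffOn ℝ ∞ h Ω) (ψ : 𝓓(Ω, ℂ)) :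
    𝓓(Ω, ℂ) where
  toFun x := h x * ψ x
  contDiff' := contDiff_mul_test (fun _ hx => hh.contDiffAt (Ω.isOpen.mem_nhds hx)) ψ.contDiff
    ψ.tsupport_subset
  hasCompactSupport' := ψ.hasCompactSupport.mul_left
  tsupport_subset' := (tsupport_mul_subset_right (f := h) (g := ψ)).trans ψ.tsupport_subset

/-- The `j`-th partial derivative of a test function. -/
def testDeriv (j : Fin n) (ψ : 𝓓(Ω, ℂ)) : 𝓓(Ω, ℂ) where
  toFun := partialDeriv j ψ
  contDiff' := (ψ.contDiff.fderiv_right (m := ∞) (by simp)).clm_apply contDiff_const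
  hasCompactSupport' := ψ.hasCompactSupport.mono' (support_partialDeriv_subset ψ)
  tsupport_subset' := (closure_minimal (support_partialDeriv_subset ψ) (isClosed_tsupport _)).trans
    ψ.tsupport_subset

/-- The complex conjugate of a test function. -/
def testConj (ψ : 𝓓(Ω, ℂ)) : 𝓓(Ω, ℂ) where
  toFun x := starRingEnd ℂ (ψ x)
  contDiff' := Complex.conjCLE.contDiff.comp ψ.contDiff
  hasCompactSupport' := ψ.hasCompactSupport.comp_left (map_zero _)
  tsupport_subset' := (tsupport_comp_subset (map_zero (starRingEnd ℂ)) ψ).trans ψ.tsupport_subset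

@[simp]
theorem testMul_apply (h : EuclideanSpace ℝ (Fin n) → ℂ) (hh : ContDiffOn ℝ ∞ h Ω) (ψ : 𝓓(Ω, ℂ))
    (x : EuclideanSpace ℝ (Fin n)) : testMul h hh ψ x = h x * ψ x := rfl

@[simp]
theorem testDeriv_apply (ψ : 𝓓(Ω, ℂ)) (x : EuclideanSpace ℝ (Fin n)) :
    testDeriv j ψ x = partialDeriv j ψ x := rfl

@[simp]
theorem testConj_apply (ψ : 𝓓(Ω, ℂ)) (x : EuclideanSpace ℝ (Fin n)) :
    testConj ψ x = starRingEnd ℂ (ψ x) := rfl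

/-- The function `∂φ/∂x_j / 2`. -/
def halfDeriv (φ : EuclideanSpace ℝ (Fin n) → ℝ) (j : Fin n) (x : EuclideanSpace ℝ (Fin n)) : ℂ :=
  (1 / 2 : ℂ) * ((partialDeriv j φ x : ℝ) : ℂ)

theorem contDiffOn_partialDeriv (hφ : ContDiffOn ℝ ∞ φ Ω) (j : Fin n) :
    ContDiffOn ℝ ∞ (partialDeriv j φ) Ω :=
  (hφ.fderiv_of_isOpen Ω.isOpen (m := ∞) (by simp)).clm_apply contDiffOn_const

theorem contDiffOn_halfDeriv (hφ : ContDiffOn ℝ ∞ φ Ω) (j : Fin n) :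
    ContDiffOn ℝ ∞ (halfDeriv φ j) Ω :=
  contDiffOn_const.mul
    (Complex.ofRealCLM.contDiff.comp_contDiffOn (contDiffOn_partialDeriv hφ j))

/-- The operator `∂_j + (∂_jφ) / 2` on test functions. -/
def wittenDeriv (hφ : ContDiffOn ℝ ∞ φ Ω) (j : Fin n) (ψ : 𝓓(Ω, ℂ)) : 𝓓(Ω, ℂ) :=
  testDeriv j ψ + testMul _ (contDiffOn_halfDeriv hφ j) ψ

/-- The formal adjoint `-∂_j + (∂_jφ) / 2` of `wittenDeriv`. -/
def wittenAdj (hφ : ContDiffOn ℝ ∞ φ Ω) (j : Fin n) (ψ : 𝓓(Ω, ℂ)) : 𝓓(Ω, ℂ) :=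
  testMul _ (contDiffOn_halfDeriv hφ j) ψ - testDeriv j ψ

@[simp]
theorem wittenDeriv_apply (hφ : ContDiffOn ℝ ∞ φ Ω) (ψ : 𝓓(Ω, ℂ))
    (x : EuclideanSpace ℝ (Fin n)) :
    wittenDeriv hφ j ψ x = partialDeriv j ψ x + halfDeriv φ j x * ψ x := rfl

@[simp]
theorem wittenAdj_apply (hφ : ContDiffOn ℝ ∞ φ Ω) (ψ : 𝓓(Ω, ℂ))
    (x : EuclideanSpace ℝ (Fin n)) :
    wittenAdj hφ j ψ x = halfDeriv φ j x * ψ x - partialDeriv j ψ x := rfl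

theorem differentiable_test (ψ : 𝓓(Ω, ℂ)) : Differentiable ℝ ψ :=
  ψ.contDiff.differentiable (by simp)

/-- The coefficient (∂_jφ)/2 is real. This lets bilinear pairings with test functions be traded for
Hermitian inner products. -/
theorem wittenAdj_conj_apply (hφ : ContDiffOn ℝ ∞ φ Ω) (ψ : 𝓓(Ω, ℂ))
    (x : EuclideanSpace ℝ (Fin n)) :
    wittenAdj hφ j (testConj ψ) x = starRingEnd ℂ (wittenAdj hφ j ψ x) := by
  have h : partialDeriv j (testConj ψ) x = starRingEnd ℂ (partialDeriv j ψ x) :=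
    partialDeriv_star (differentiable_test ψ x)
  have h2 : starRingEnd ℂ (halfDeriv φ j x) = halfDeriv φ j x := by
    rw [halfDeriv, map_mul, Complex.conj_ofReal, map_div₀, map_one, map_ofNat]
  simp [h, h2]

/-! ### Weak derivatives as integral identities with D_j* -/

theorem integrableOn_mul_test {f : EuclideanSpace ℝ (Fin n) → ℂ} (hf : LocallyIntegrableOn f Ω)
    (ψ : 𝓓(Ω, ℂ)) : IntegrableOn (fun x => f x * ψ x) Ω :=
  integrableOn_mul_of_tsupport_subset hf ψ.continuous ψ (subset_tsupport _)

theorem locallyIntegrableOn_L2 (u : L2 Ω) : LocallyIntegrableOn u Ω :=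
  locallyIntegrableOn_of_locallyIntegrable_restrict ((Lp.memLp u).locallyIntegrable (by norm_num))

theorem locallyIntegrableOn_test (ψ : 𝓓(Ω, ℂ)) : LocallyIntegrableOn ψ Ω :=
  ψ.continuous.locallyIntegrable.locallyIntegrableOn _

/-- Here g plays the role of D_j f: the zeroth-order term is moved onto the test function, and -∂_j
+ (∂_jφ)/2 is the transpose of ∂_j + (∂_jφ)/2. -/
theorem hasWeakPartialDeriv_sub_iff (hφ : ContDiffOn ℝ ∞ φ Ω)
    {f g : EuclideanSpace ℝ (Fin n) → ℂ} (hf : LocallyIntegrableOn f Ω)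
    (hg : LocallyIntegrableOn g Ω) :
    HasWeakPartialDeriv Ω j f (fun x => g x - halfDeriv φ j x * f x) ↔
      ∀ ψ : 𝓓(Ω, ℂ), ∫ x in Ω, f x * wittenAdj hφ j ψ x = ∫ x in Ω, g x * ψ x := by
  have hm : LocallyIntegrableOn (fun x => halfDeriv φ j x * f x) Ω :=
    hf.continuousOn_mul (contDiffOn_halfDeriv hφ j).continuousOn Ω.isOpen.isLocallyClosed
  refine ⟨fun h ψ => ?_, fun h => ⟨hf, hg.sub hm, fun ψ => ?_⟩⟩
  all_goals
    have e1 : ∫ x in Ω, f x * wittenAdj hφ j ψ x =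
        (∫ x in Ω, halfDeriv φ j x * f x * ψ x) - ∫ x in Ω, f x * testDeriv j ψ x := by
      rw [← integral_sub (integrableOn_mul_test hm ψ) (integrableOn_mul_test hf (testDeriv j ψ))]
      refine integral_congr_ae (Eventually.of_forall fun x => ?_)
      simp only [wittenAdj_apply, testDeriv_apply]
      ring
    have e2 : ∫ x in Ω, (g x - halfDeriv φ j x * f x) * ψ x =
        (∫ x in Ω, g x * ψ x) - ∫ x in Ω, halfDeriv φ j x * f x * ψ x := by
      rw [← integral_sub (integrableOn_mul_test hg ψ) (integrableOn_mul_test hm ψ)]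
      simp only [sub_mul]
  · have e3 : ∫ x in Ω, f x * testDeriv j ψ x = _ := h.2.2 ψ
    rw [e1, e3, e2]
    ring
  · have e3 := h ψ
    rw [e1] at e3
    rw [e2, ← e3]
    simp only [testDeriv_apply]
    ring

theorem partialDeriv_cexp_mul {a : EuclideanSpace ℝ (Fin n) → ℝ} {x : EuclideanSpace ℝ (Fin n)}
    {ψ : EuclideanSpace ℝ (Fin n) → ℂ} (ha : DifferentiableAt ℝ a x)
    (hψ : DifferentiableAt ℝ ψ x) :
    partialDeriv j (fun y => (Real.exp (a y) : ℂ) * ψ y) x =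
      (Real.exp (a x) : ℂ) * (partialDeriv j ψ x + ((partialDeriv j a x : ℝ) : ℂ) * ψ x) := by
  have he : DifferentiableAt ℝ (fun y => Real.exp (a y)) x := ha.exp
  have hc : DifferentiableAt ℝ (fun y => (Real.exp (a y) : ℂ)) x :=
    Complex.ofRealCLM.differentiableAt.comp x he
  have e : partialDeriv j (fun y => Real.exp (a y)) x = Real.exp (a x) * partialDeriv j a x := by
    simp only [partialDeriv]
    rw [fderiv_exp ha]
    simp
  rw [partialDeriv_mul hc hψ, partialDeriv_ofReal he, e]
  push_cast
  ring

theorem contDiffOn_cexp (hφ : ContDiffOn ℝ ∞ φ Ω) (c : ℝ) :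
    ContDiffOn ℝ ∞ (fun x => (Real.exp (c * φ x) : ℂ)) Ω :=
  Complex.ofRealCLM.contDiff.comp_contDiffOn (contDiffOn_const.mul hφ).exp

/-- Because ∂_j(e^{-φ/2}ψ) = -e^{-φ/2} D_j*ψ, testing ∂_j f = g against e^{-φ/2}ψ is testing D_j u =
v against ψ. -/
theorem hasWeakPartialDeriv_iff_weighted (hφ : ContDiffOn ℝ ∞ φ Ω)
    {f g u v : EuclideanSpace ℝ (Fin n) → ℂ} (hf : LocallyIntegrableOn f Ω)
    (hg : LocallyIntegrableOn g Ω)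
    (hu : u =ᵐ[volume.restrict Ω] fun x => (Real.exp (-1 / 2 * φ x) : ℂ) * f x)
    (hv : v =ᵐ[volume.restrict Ω] fun x => (Real.exp (-1 / 2 * φ x) : ℂ) * g x) :
    HasWeakPartialDeriv Ω j f g ↔
      ∀ ψ : 𝓓(Ω, ℂ), ∫ x in Ω, u x * wittenAdj hφ j ψ x = ∫ x in Ω, v x * ψ x := by
  have key : ∀ ψ : 𝓓(Ω, ℂ),
      (∫ x in Ω, u x * wittenAdj hφ j ψ x = -∫ x in Ω, f x *
        partialDeriv j (testMul _ (contDiffOn_cexp hφ (-1 / 2)) ψ) x) ∧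
      ∫ x in Ω, v x * ψ x = ∫ x in Ω, g x * testMul _ (contDiffOn_cexp hφ (-1 / 2)) ψ x := by
    intro ψ
    constructor
    · rw [← integral_neg]
      refine integral_congr_ae ?_
      filter_upwards [hu, ae_restrict_mem Ω.isOpen.measurableSet] with x hx hxΩ
      have hd : DifferentiableAt ℝ φ x :=
        (hφ.contDiffAt (Ω.isOpen.mem_nhds hxΩ)).differentiableAt (by simp)
      have e : partialDeriv j (testMul _ (contDiffOn_cexp hφ (-1 / 2)) ψ) x =
          (Real.exp (-1 / 2 * φ x) : ℂ) * (partialDeriv j ψ x - halfDeriv φ j x * ψ x) := by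
        refine (partialDeriv_cexp_mul (hd.const_mul _) (differentiable_test ψ x)).trans ?_
        have e' : partialDeriv j (fun y => -1 / 2 * φ y) x = -1 / 2 * partialDeriv j φ x := by
          simp only [partialDeriv]
          rw [fderiv_const_mul hd]
          simp
        rw [e', halfDeriv]
        push_cast
        ring
      rw [e, hx, wittenAdj_apply]
      ring
    · refine integral_congr_ae ?_
      filter_upwards [hv] with x hx
      rw [hx, testMul_apply]
      ring
  constructor
  · intro h ψ
    rw [(key ψ).1, (key ψ).2, h.2.2, neg_neg]
  · intro h
    refine ⟨hf, hg, fun ψ => ?_⟩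
    -- Every test function has the form e^{-φ/2}ψ, so nothing is lost by testing only with these.
    have e : testMul _ (contDiffOn_cexp hφ (-1 / 2)) (testMul _ (contDiffOn_cexp hφ (1 / 2)) ψ)
        = ψ := by
      ext x
      rw [testMul_apply, testMul_apply, ← mul_assoc, ← Complex.ofReal_mul, ← Real.exp_add,
        show -1 / 2 * φ x + 1 / 2 * φ x = 0 by ring, Real.exp_zero, Complex.ofReal_one, one_mul]
    have h' := h (testMul _ (contDiffOn_cexp hφ (1 / 2)) ψ)
    rw [(key _).1, (key _).2, e] at h'
    rw [← h', neg_neg]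

/-! ### Test functions in L²(Ω) and the factorisation of -Δ + V₁ -/

/-- A test function as an element of `L²(Ω)`. -/
def testToL2 (ψ : 𝓓(Ω, ℂ)) : L2 Ω :=
  (ψ.continuous.memLp_of_hasCompactSupport ψ.hasCompactSupport).toLp ψ

theorem coeFn_testToL2 (ψ : 𝓓(Ω, ℂ)) : testToL2 ψ =ᵐ[volume.restrict Ω] ψ :=
  MemLp.coeFn_toLp _

theorem testToL2_add (ψ χ : 𝓓(Ω, ℂ)) : testToL2 (ψ + χ) = testToL2 ψ + testToL2 χ := rfl

theorem testToL2_zero : testToL2 (0 : 𝓓(Ω, ℂ)) = 0 := rfl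

theorem testToL2_sum {ι : Type*} (s : Finset ι) (ψ : ι → 𝓓(Ω, ℂ)) :
    testToL2 (∑ i ∈ s, ψ i) = ∑ i ∈ s, testToL2 (ψ i) :=
  map_sum (⟨⟨testToL2, testToL2_zero⟩, testToL2_add⟩ : 𝓓(Ω, ℂ) →+ L2 Ω) ψ s

theorem inner_testToL2 (ψ : 𝓓(Ω, ℂ)) (u : L2 Ω) :
    ⟪testToL2 ψ, u⟫_ℂ = ∫ x in Ω, u x * testConj ψ x := by
  rw [MeasureTheory.L2.inner_def]
  refine integral_congr_ae ?_
  filter_upwards [coeFn_testToL2 ψ] with x hx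
  rw [hx]
  rfl

theorem testConj_testConj (ψ : 𝓓(Ω, ℂ)) : testConj (testConj ψ) = ψ := by
  ext x
  simp

theorem forall_inner_wittenAdj_iff (hφ : ContDiffOn ℝ ∞ φ Ω) (u v : L2 Ω) :
    (∀ ψ : 𝓓(Ω, ℂ), ∫ x in Ω, u x * wittenAdj hφ j ψ x = ∫ x in Ω, v x * ψ x) ↔
      ∀ ψ : 𝓓(Ω, ℂ), ⟪testToL2 (wittenAdj hφ j ψ), u⟫_ℂ = ⟪testToL2 ψ, v⟫_ℂ := by
  have e : ∀ ψ : 𝓓(Ω, ℂ), testConj (wittenAdj hφ j ψ) = wittenAdj hφ j (testConj ψ) := fun ψ => by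
    ext x
    rw [wittenAdj_conj_apply, testConj_apply]
  simp only [inner_testToL2, e]
  refine ⟨fun h ψ => h _, fun h ψ => ?_⟩
  have := h (testConj ψ)
  rwa [testConj_testConj] at this

/-- With the weak gradient expressed by inner products against fixed vectors, the later arguments
need only Hilbert space geometry. -/
theorem hasWittenGradient_iff (hφ : ContDiffOn ℝ ∞ φ Ω) (u : L2 Ω) (g : Fin n → L2 Ω) :
    HasWittenGradient φ u g ↔
      ∀ (j : Fin n) (ψ : 𝓓(Ω, ℂ)), ⟪testToL2 (wittenAdj hφ j ψ), u⟫_ℂ = ⟪testToL2 ψ, g j⟫_ℂ :=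
  forall_congr' fun j => (hasWeakPartialDeriv_sub_iff hφ (locallyIntegrableOn_L2 u)
    (locallyIntegrableOn_L2 (g j))).trans (forall_inner_wittenAdj_iff hφ u (g j))

theorem hasWeakPartialDeriv_test (ψ : 𝓓(Ω, ℂ)) :
    HasWeakPartialDeriv Ω j ψ (partialDeriv j ψ) := by
  refine ⟨locallyIntegrableOn_test ψ, locallyIntegrableOn_test (testDeriv j ψ), fun χ => ?_⟩
  have h1 := integrableOn_mul_test (locallyIntegrableOn_test ψ) (testDeriv j χ)
  have h2 := integrableOn_mul_test (locallyIntegrableOn_test (testDeriv j ψ)) χ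
  rw [← add_eq_zero_iff_eq_neg]
  refine (integral_add h1 h2).symm.trans ?_
  have hc : HasCompactSupport fun x => ψ x * χ x := χ.hasCompactSupport.mul_left
  have hs : ContDiff ℝ 1 fun x => ψ x * χ x :=
    (ψ.contDiff.mul χ.contDiff).of_le (by simp)
  rw [setIntegral_eq_integral_of_forall_compl_eq_zero, ← integral_partialDeriv_eq_zero hs hc]
  · refine integral_congr_ae (Eventually.of_forall fun x => ?_)
    exact (partialDeriv_mul (differentiable_test ψ x) (differentiable_test χ x)).symm
  · intro x hx
    have e1 : χ x = 0 := image_eq_zero_of_notMem_tsupport fun h => hx (χ.tsupport_subset h)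
    have e2 : testDeriv j χ x = 0 :=
      image_eq_zero_of_notMem_tsupport fun h => hx ((testDeriv j χ).tsupport_subset h)
    rw [e1, e2, mul_zero, mul_zero, add_zero]

theorem hasWittenGradient_test (hφ : ContDiffOn ℝ ∞ φ Ω) (ψ : 𝓓(Ω, ℂ)) :
    HasWittenGradient φ (testToL2 ψ) fun j => testToL2 (wittenDeriv hφ j ψ) := fun j => by
  refine (hasWeakPartialDeriv_test ψ).congr (coeFn_testToL2 ψ).symm ?_
  filter_upwards [coeFn_testToL2 ψ, coeFn_testToL2 (wittenDeriv hφ j ψ)] with x h1 h2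
  rw [h1, h2, wittenDeriv_apply, halfDeriv]
  ring

/-- This is density of test functions, from the fundamental lemma of the calculus of variations;
real-valued test functions already suffice. -/
theorem span_testToL2_orthogonal : (Submodule.span ℂ (range (testToL2 (Ω := Ω))))ᗮ = ⊥ := by
  rw [Submodule.eq_bot_iff]
  intro u hu
  have h := Ω.isOpen.ae_eq_zero_of_integral_contDiff_smul_eq_zero (locallyIntegrableOn_L2 u)
    fun g hg hc hs => by
      let ψ : 𝓓(Ω, ℂ) := ⟨fun x => (g x : ℂ), Complex.ofRealCLM.contDiff.comp hg,
        hc.comp_left Complex.ofReal_zero,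
        (tsupport_comp_subset Complex.ofReal_zero g).trans hs⟩
      have e := Submodule.inner_right_of_mem_orthogonal (Submodule.subset_span (mem_range_self ψ)) hu
      rw [inner_testToL2] at e
      rw [← e, setIntegral_eq_integral_of_forall_compl_eq_zero]
      · refine integral_congr_ae (Eventually.of_forall fun x => ?_)
        have : testConj ψ x = (g x : ℂ) := Complex.conj_ofReal _
        simp only [this, Complex.real_smul, mul_comm]
      · intro x hx
        rw [image_eq_zero_of_notMem_tsupport fun h => hx ((testConj ψ).tsupport_subset h), mul_zero]
  refine Lp.ext ?_
  filter_upwards [(ae_restrict_iff' Ω.isOpen.measurableSet).2 h,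
    Lp.coeFn_zero ℂ 2 (volume.restrict (Ω : Set (EuclideanSpace ℝ (Fin n))))] with x h1 h2
  rw [h1, h2, Pi.zero_apply]

/-- With a = (∂_jφ)/2 the first-order terms cancel: (-∂_j + a)(∂_j + a)ψ = -∂_j²ψ + (a² - ∂_j a)ψ,
and ∑ (a² - ∂_j a) is V₁. -/
theorem schrodingerExpr_eq_sum (hφ : ContDiffOn ℝ ∞ φ Ω) (ψ : 𝓓(Ω, ℂ))
    {x : EuclideanSpace ℝ (Fin n)} (hx : x ∈ Ω) :
    schrodingerExpr (potential φ) ψ x = ∑ j, wittenAdj hφ j (wittenDeriv hφ j ψ) x := by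
  have hφx : ContDiffAt ℝ ∞ φ x := hφ.contDiffAt (Ω.isOpen.mem_nhds hx)
  have hd : ∀ j, DifferentiableAt ℝ (partialDeriv j φ) x := fun j =>
    ((contDiffOn_partialDeriv hφ j).contDiffAt (Ω.isOpen.mem_nhds hx)).differentiableAt (by simp)
  have hh : ∀ j, DifferentiableAt ℝ (halfDeriv φ j) x := fun j =>
    ((contDiffOn_halfDeriv hφ j).contDiffAt (Ω.isOpen.mem_nhds hx)).differentiableAt (by simp)
  simp only [schrodingerExpr, potential, norm_gradient_sq, laplacian_eq_sum (hφx.of_le two_le_infty),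
    laplacian_eq_sum (contDiff_two_test ψ).contDiffAt]
  push_cast
  simp only [Finset.mul_sum, ← Finset.sum_neg_distrib, ← Finset.sum_sub_distrib, Finset.sum_mul,
    ← Finset.sum_add_distrib]
  refine Finset.sum_congr rfl fun j _ => ?_
  have e1 : partialDeriv j (halfDeriv φ j) x =
      (1 / 2 : ℂ) * ((partialDeriv j (partialDeriv j φ) x : ℝ) : ℂ) :=
    (partialDeriv_const_mul _ (Complex.ofRealCLM.differentiableAt.comp x (hd j))).trans
      (by rw [← partialDeriv_ofReal (hd j)]; rfl)
  have e2 : partialDeriv j (wittenDeriv hφ j ψ) x = partialDeriv j (partialDeriv j ψ) x +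
      (halfDeriv φ j x * partialDeriv j ψ x + partialDeriv j (halfDeriv φ j) x * ψ x) :=
    (partialDeriv_add (differentiable_test (testDeriv j ψ) x)
      (differentiable_test (testMul _ (contDiffOn_halfDeriv hφ j) ψ) x)).trans
      (congrArg _ (partialDeriv_mul (hh j) (differentiable_test ψ x)))
  rw [wittenAdj_apply, wittenDeriv_apply, e2, e1, halfDeriv]
  ring

theorem mem_graph_schrodingerOperator_iff (hφ : ContDiffOn ℝ ∞ φ Ω) (u w : L2 Ω) :
    (u, w) ∈ (schrodingerOperator Ω (potential φ)).graph ↔ ∃ ψ : 𝓓(Ω, ℂ), testToL2 ψ = u ∧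
      ∑ j, testToL2 (wittenAdj hφ j (wittenDeriv hφ j ψ)) = w := by
  rw [schrodingerOperator_graph]
  refine exists_congr fun ψ => and_congr ?_ ?_
  · exact ⟨fun h => Lp.ext ((coeFn_testToL2 ψ).trans h.symm), fun h => h ▸ coeFn_testToL2 ψ⟩
  · have e : testToL2 (∑ j, wittenAdj hφ j (wittenDeriv hφ j ψ)) =ᵐ[volume.restrict Ω]
        schrodingerExpr (potential φ) ψ := by
      filter_upwards [coeFn_testToL2 (∑ j, wittenAdj hφ j (wittenDeriv hφ j ψ)),
        ae_restrict_mem Ω.isOpen.measurableSet] with x h1 h2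
      rw [h1, schrodingerExpr_eq_sum hφ ψ h2, FunLike.coe_sum, Finset.sum_apply]
    rw [← testToL2_sum]
    exact ⟨fun h => Lp.ext (e.trans h.symm), fun h => h ▸ e⟩

theorem exists_test_of_mem_domain (hφ : ContDiffOn ℝ ∞ φ Ω)
    (x : (schrodingerOperator Ω (potential φ)).domain) : ∃ ψ : 𝓓(Ω, ℂ), testToL2 ψ = x ∧
      ∑ j, testToL2 (wittenAdj hφ j (wittenDeriv hφ j ψ)) =
        schrodingerOperator Ω (potential φ) x :=
  (mem_graph_schrodingerOperator_iff hφ _ _).1 (LinearPMap.mem_graph _ x)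

theorem testToL2_mem_domain (hφ : ContDiffOn ℝ ∞ φ Ω) (ψ : 𝓓(Ω, ℂ)) :
    testToL2 ψ ∈ (schrodingerOperator Ω (potential φ)).domain :=
  LinearPMap.mem_domain_of_mem_graph
    ((mem_graph_schrodingerOperator_iff hφ _ _).2 ⟨ψ, rfl, rfl⟩)

theorem dense_domain_schrodingerOperator (hφ : ContDiffOn ℝ ∞ φ Ω) :
    Dense ((schrodingerOperator Ω (potential φ)).domain : Set (L2 Ω)) := by
  rw [Submodule.dense_iff_topologicalClosure_eq_top, eq_top_iff,
    ← (Submodule.topologicalClosure_eq_top_iff).2 (span_testToL2_orthogonal (Ω := Ω))]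
  refine Submodule.topologicalClosure_mono (Submodule.span_le.2 ?_)
  rintro _ ⟨ψ, rfl⟩
  exact testToL2_mem_domain hφ ψ

/-- Each D_jψ is again a test function, so the weak definition of the gradient of u may be tested
with it; no boundary term arises for any u in the maximal form domain. -/
theorem inner_schrodinger_eq (hφ : ContDiffOn ℝ ∞ φ Ω) (ψ : 𝓓(Ω, ℂ)) {u : L2 Ω}
    {g : Fin n → L2 Ω} (hu : HasWittenGradient φ u g) :
    ⟪∑ j, testToL2 (wittenAdj hφ j (wittenDeriv hφ j ψ)), u⟫_ℂ =
      ∑ j, ⟪testToL2 (wittenDeriv hφ j ψ), g j⟫_ℂ := by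
  rw [sum_inner]
  exact Finset.sum_congr rfl fun j _ => (hasWittenGradient_iff hφ u g).1 hu j _

theorem HasWittenGradient.unique (hφ : ContDiffOn ℝ ∞ φ Ω) {u : L2 Ω} {g h : Fin n → L2 Ω}
    (hg : HasWittenGradient φ u g) (hh : HasWittenGradient φ u h) : g = h := by
  rw [hasWittenGradient_iff hφ] at hg hh
  funext j
  have hle : Submodule.span ℂ (range (testToL2 (Ω := Ω))) ≤ (ℂ ∙ (g j - h j))ᗮ := by
    refine Submodule.span_le.2 ?_
    rintro _ ⟨ψ, rfl⟩
    rw [SetLike.mem_coe, Submodule.mem_orthogonal_singleton_iff_inner_left, inner_sub_right,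
      ← hg, ← hh, sub_self]
  have := Submodule.orthogonal_le hle
    (Submodule.le_orthogonal_orthogonal _ (Submodule.mem_span_singleton_self _))
  rwa [span_testToL2_orthogonal, Submodule.mem_bot, sub_eq_zero] at this

/-! ### The unitary equivalence with the unweighted space -/

theorem aemeasurable_weight (hφ : ContDiffOn ℝ ∞ φ Ω) :
    AEMeasurable (fun x => ENNReal.ofReal (Real.exp (-φ x)))
      (volume.restrict (Ω : Set (EuclideanSpace ℝ (Fin n)))) :=
  (Real.measurable_exp.comp_aemeasurable
    (hφ.continuousOn.aemeasurable Ω.isOpen.measurableSet).neg).ennreal_ofReal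

/-- The density e^{-φ} is the square of e^{-φ/2}. -/
theorem eLpNorm_weightedMeasure (hφ : ContDiffOn ℝ ∞ φ Ω) (f : EuclideanSpace ℝ (Fin n) → ℂ) :
    eLpNorm f 2 (weightedMeasure Ω φ) =
      eLpNorm (fun x => (Real.exp (-1 / 2 * φ x) : ℂ) * f x) 2 (volume.restrict Ω) := by
  rw [eLpNorm_eq_lintegral_rpow_enorm_toReal (by simp) (by simp),
    eLpNorm_eq_lintegral_rpow_enorm_toReal (by simp) (by simp), weightedMeasure,
    lintegral_withDensity_eq_lintegral_mul_non_measurable₀ _ (aemeasurable_weight hφ) (by simp)]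
  congr 1
  refine lintegral_congr fun x => ?_
  have e : ‖(Real.exp (-1 / 2 * φ x) : ℂ)‖ₑ ^ (2 : ℝ) = ENNReal.ofReal (Real.exp (-φ x)) := by
    rw [← ofReal_norm, Complex.norm_real, Real.norm_of_nonneg (Real.exp_pos _).le,
      ENNReal.rpow_two, ← ENNReal.ofReal_pow (Real.exp_pos _).le, ← Real.exp_nat_mul]
    congr 2
    push_cast
    ring
  simp only [Pi.mul_apply, ENNReal.toReal_ofNat, enorm_mul]
  rw [ENNReal.mul_rpow_of_nonneg _ _ (by norm_num), e]

theorem cexp_mul_cexp_mul (a : ℝ) (z : ℂ) :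
    (Real.exp (1 / 2 * a) : ℂ) * ((Real.exp (-1 / 2 * a) : ℂ) * z) = z := by
  rw [← mul_assoc, ← Complex.ofReal_mul, ← Real.exp_add,
    show 1 / 2 * a + -1 / 2 * a = 0 by ring, Real.exp_zero, Complex.ofReal_one, one_mul]

theorem memLp_weightedMeasure_iff (hφ : ContDiffOn ℝ ∞ φ Ω) (f : EuclideanSpace ℝ (Fin n) → ℂ) :
    MemLp f 2 (weightedMeasure Ω φ) ↔
      MemLp (fun x => (Real.exp (-1 / 2 * φ x) : ℂ) * f x) 2 (volume.restrict Ω) := by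
  have he : ∀ c : ℝ, AEStronglyMeasurable (fun x => (Real.exp (c * φ x) : ℂ))
      (volume.restrict (Ω : Set (EuclideanSpace ℝ (Fin n)))) := fun c =>
    (contDiffOn_cexp hφ c).continuousOn.aestronglyMeasurable Ω.isOpen.measurableSet
  refine and_congr ⟨fun h => ?_, fun h => ?_⟩ (by rw [eLpNorm_weightedMeasure hφ])
  · exact (he _).mul (h.mono_ac (withDensity_absolutelyContinuous' (aemeasurable_weight hφ)
      (Eventually.of_forall fun x => by simp [Real.exp_pos])))
  · refine (((he (1 / 2)).mul h).congr (Eventually.of_forall fun x => ?_)).mono_ac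
      (withDensity_absolutelyContinuous _ _)
    exact cexp_mul_cexp_mul _ _

/-- The isometry `f ↦ e^{-φ/2} f` from `L²(Ω, φ)` into `L²(Ω)`. -/
def weightIsometry (hφ : ContDiffOn ℝ ∞ φ Ω) : WeightedL2 Ω φ →ₗᵢ[ℂ] L2 Ω where
  toFun f := ((memLp_weightedMeasure_iff hφ f).1 (Lp.memLp f)).toLp _
  map_add' f g := by
    refine Lp.ext ?_
    filter_upwards [MemLp.coeFn_toLp ((memLp_weightedMeasure_iff hφ _).1 (Lp.memLp (f + g))),
      MemLp.coeFn_toLp ((memLp_weightedMeasure_iff hφ f).1 (Lp.memLp f)),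
      MemLp.coeFn_toLp ((memLp_weightedMeasure_iff hφ g).1 (Lp.memLp g)),
      Lp.coeFn_add (((memLp_weightedMeasure_iff hφ f).1 (Lp.memLp f)).toLp _)
        (((memLp_weightedMeasure_iff hφ g).1 (Lp.memLp g)).toLp _),
      (ae_weighted_iff hφ).1 (Lp.coeFn_add f g)] with x h1 h2 h3 h4 h5
    rw [h1, h4, Pi.add_apply, h2, h3, h5, Pi.add_apply, mul_add]
  map_smul' c f := by
    refine Lp.ext ?_
    filter_upwards [MemLp.coeFn_toLp ((memLp_weightedMeasure_iff hφ _).1 (Lp.memLp (c • f))),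
      MemLp.coeFn_toLp ((memLp_weightedMeasure_iff hφ f).1 (Lp.memLp f)),
      Lp.coeFn_smul c (((memLp_weightedMeasure_iff hφ f).1 (Lp.memLp f)).toLp _),
      (ae_weighted_iff hφ).1 (Lp.coeFn_smul c f)] with x h1 h2 h3 h4
    rw [h1, RingHom.id_apply, h3, Pi.smul_apply, h2, h4, Pi.smul_apply, smul_eq_mul, smul_eq_mul]
    ring
  norm_map' f := by
    refine (Lp.norm_toLp _ ((memLp_weightedMeasure_iff hφ f).1 (Lp.memLp f))).trans ?_
    rw [← eLpNorm_weightedMeasure hφ, Lp.norm_def]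

theorem coeFn_weightIsometry (hφ : ContDiffOn ℝ ∞ φ Ω) (f : WeightedL2 Ω φ) :
    weightIsometry hφ f =ᵐ[volume.restrict Ω] fun x => (Real.exp (-1 / 2 * φ x) : ℂ) * f x :=
  MemLp.coeFn_toLp ((memLp_weightedMeasure_iff hφ f).1 (Lp.memLp f))

theorem surjective_weightIsometry (hφ : ContDiffOn ℝ ∞ φ Ω) :
    Function.Surjective (weightIsometry hφ) := by
  intro u
  have e : ∀ x, (Real.exp (-1 / 2 * φ x) : ℂ) * ((Real.exp (1 / 2 * φ x) : ℂ) * u x) = u x :=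
    fun x => by rw [mul_left_comm, cexp_mul_cexp_mul]
  have hf : MemLp (fun x => (Real.exp (1 / 2 * φ x) : ℂ) * u x) 2 (weightedMeasure Ω φ) := by
    rw [memLp_weightedMeasure_iff hφ]
    simp only [e]
    exact Lp.memLp u
  refine ⟨hf.toLp _, Lp.ext ?_⟩
  filter_upwards [coeFn_weightIsometry hφ (hf.toLp _), (ae_weighted_iff hφ).1 hf.coeFn_toLp]
    with x h1 h2
  rw [h1, h2, e]

/-- The unitary map `f ↦ e^{-φ/2} f` from `L²(Ω, φ)` onto `L²(Ω)`. -/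
def weightEquiv (hφ : ContDiffOn ℝ ∞ φ Ω) : WeightedL2 Ω φ ≃ₗᵢ[ℂ] L2 Ω :=
  LinearIsometryEquiv.ofSurjective (weightIsometry hφ) (surjective_weightIsometry hφ)

theorem coeFn_weightEquiv (hφ : ContDiffOn ℝ ∞ φ Ω) (f : WeightedL2 Ω φ) :
    weightEquiv hφ f =ᵐ[volume.restrict Ω] fun x => (Real.exp (-1 / 2 * φ x) : ℂ) * f x :=
  coeFn_weightIsometry hφ f

theorem locallyIntegrableOn_weightedL2 (hφ : ContDiffOn ℝ ∞ φ Ω) (f : WeightedL2 Ω φ) :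
    LocallyIntegrableOn f Ω := by
  refine ((locallyIntegrableOn_L2 (weightEquiv hφ f)).continuousOn_mul
    (contDiffOn_cexp hφ (1 / 2)).continuousOn Ω.isOpen.isLocallyClosed).congr ?_
  filter_upwards [coeFn_weightEquiv hφ f] with x hx
  rw [hx, cexp_mul_cexp_mul]

theorem hasWeakPartialDeriv_iff_inner (hφ : ContDiffOn ℝ ∞ φ Ω) (f g : WeightedL2 Ω φ) :
    HasWeakPartialDeriv Ω j f g ↔ ∀ ψ : 𝓓(Ω, ℂ),
      ⟪testToL2 (wittenAdj hφ j ψ), weightEquiv hφ f⟫_ℂ = ⟪testToL2 ψ, weightEquiv hφ g⟫_ℂ :=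
  (hasWeakPartialDeriv_iff_weighted hφ (locallyIntegrableOn_weightedL2 hφ f)
    (locallyIntegrableOn_weightedL2 hφ g) (coeFn_weightEquiv hφ f)
    (coeFn_weightEquiv hφ g)).trans (forall_inner_wittenAdj_iff hφ _ _)

/-- Under the unitary map, H¹(Ω, φ) corresponds to the maximal form domain: both memberships reduce
to the same inner product identities. -/
theorem mem_sobolevH1_iff (hφ : ContDiffOn ℝ ∞ φ Ω)
    (w : WithLp 2 (WeightedL2 Ω φ × PiLp 2 fun _ : Fin n => WeightedL2 Ω φ)) :
    w ∈ sobolevH1 hφ ↔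
      HasWittenGradient φ (weightEquiv hφ w.fst) fun j => weightEquiv hφ (w.snd j) :=
  (forall_congr' fun _ => hasWeakPartialDeriv_iff_inner hφ _ _).trans
    (hasWittenGradient_iff hφ _ _).symm

/-- Each test function imposes one equation between continuous functions of w. The resulting
completeness is what allows the adjoint of the embedding to be formed. -/
theorem isClosed_sobolevH1 (hφ : ContDiffOn ℝ ∞ φ Ω) :
    IsClosed (sobolevH1 hφ : Set (WithLp 2
      (WeightedL2 Ω φ × PiLp 2 fun _ : Fin n => WeightedL2 Ω φ))) := by
  have e : (sobolevH1 hφ : Set (WithLp 2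
      (WeightedL2 Ω φ × PiLp 2 fun _ : Fin n => WeightedL2 Ω φ))) =
      ⋂ (j : Fin n) (ψ : 𝓓(Ω, ℂ)), {w | ⟪testToL2 (wittenAdj hφ j ψ), weightEquiv hφ w.fst⟫_ℂ =
        ⟪testToL2 ψ, weightEquiv hφ (w.snd j)⟫_ℂ} := by
    ext w
    simp only [mem_iInter, mem_ofPred_eq, SetLike.mem_coe]
    exact forall_congr' fun _ => hasWeakPartialDeriv_iff_inner hφ _ _
  rw [e]
  refine isClosed_iInter fun j => isClosed_iInter fun ψ => isClosed_eq ?_ ?_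
  · fun_prop
  · fun_prop

instance completeSpace_sobolevH1 (hφ : ContDiffOn ℝ ∞ φ Ω) : CompleteSpace (sobolevH1 hφ) :=
  (isClosed_sobolevH1 hφ).completeSpace_coe

/-- After the unitary map, this is ⟪v, w⟫ + q, written with the inner products of L²(Ω). -/
theorem inner_sobolevH1 (hφ : ContDiffOn ℝ ∞ φ Ω) (v w : sobolevH1 hφ) :
    ⟪v, w⟫_ℂ = ⟪weightEquiv hφ v.1.fst, weightEquiv hφ w.1.fst⟫_ℂ +
      ∑ j, ⟪weightEquiv hφ (v.1.snd j), weightEquiv hφ (w.1.snd j)⟫_ℂ := by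
  rw [Submodule.coe_inner, WithLp.prod_inner_apply, PiLp.inner_apply]
  simp only [LinearIsometryEquiv.inner_map_map]
  rfl

theorem exists_sobolevH1_of_hasWittenGradient (hφ : ContDiffOn ℝ ∞ φ Ω) {u : L2 Ω}
    {g : Fin n → L2 Ω} (h : HasWittenGradient φ u g) :
    ∃ w : sobolevH1 hφ, weightEquiv hφ w.1.fst = u ∧ ∀ j, weightEquiv hφ (w.1.snd j) = g j := by
  refine ⟨⟨WithLp.toLp 2 ((weightEquiv hφ).symm u,
    WithLp.toLp 2 fun j => (weightEquiv hφ).symm (g j)), ?_⟩, ?_, fun j => ?_⟩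
  · rw [mem_sobolevH1_iff]
    simpa using h
  · simp
  · simp

/-! ### The realizations as form operators -/

/-- The map `f ↦ e^{-φ/2} f` from `H¹(Ω, φ)` to `L²(Ω)`. -/
def neumannEmbedding (hφ : ContDiffOn ℝ ∞ φ Ω) : sobolevH1 hφ →L[ℂ] L2 Ω :=
  (weightEquiv hφ).toContinuousLinearEquiv.toContinuousLinearMap ∘L embeddingH1 hφ

theorem neumannEmbedding_apply (hφ : ContDiffOn ℝ ∞ φ Ω) (w : sobolevH1 hφ) :
    neumannEmbedding hφ w = weightEquiv hφ w.1.fst := rfl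

theorem isCompactOperator_weightEquiv_comp_iff (hφ : ContDiffOn ℝ ∞ φ Ω) {V : Type*} [Zero V]
    [TopologicalSpace V] (f : V → WeightedL2 Ω φ) :
    IsCompactOperator (fun v => weightEquiv hφ (f v)) ↔ IsCompactOperator f := by
  constructor
  · rintro ⟨K, hK, h⟩
    refine ⟨(weightEquiv hφ).symm '' K, hK.image (weightEquiv hφ).symm.continuous, ?_⟩
    filter_upwards [h] with v hv
    exact ⟨_, hv, (weightEquiv hφ).symm_apply_apply (f v)⟩
  · rintro ⟨K, hK, h⟩
    refine ⟨weightEquiv hφ '' K, hK.image (weightEquiv hφ).continuous, ?_⟩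
    filter_upwards [h] with v hv
    exact ⟨_, hv, rfl⟩

/-- Uniqueness of the weak gradient identifies that of t with (D_jψ)_j; integration by parts then
turns q into the pairing with (-Δ + V₁)ψ. -/
theorem inner_sobolevH1_of_test (hφ : ContDiffOn ℝ ∞ φ Ω) {ψ : 𝓓(Ω, ℂ)} {t : sobolevH1 hφ}
    (ht : neumannEmbedding hφ t = testToL2 ψ) (v : sobolevH1 hφ) :
    ⟪t, v⟫_ℂ = ⟪testToL2 ψ + ∑ j, testToL2 (wittenAdj hφ j (wittenDeriv hφ j ψ)),
      neumannEmbedding hφ v⟫_ℂ := by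
  have h1 := (mem_sobolevH1_iff hφ t.1).1 t.2
  rw [neumannEmbedding_apply] at ht
  rw [ht] at h1
  have h2 := h1.unique hφ (hasWittenGradient_test hφ ψ)
  rw [inner_sobolevH1, ht, inner_add_left, neumannEmbedding_apply,
    inner_schrodinger_eq hφ ψ ((mem_sobolevH1_iff hφ v.1).1 v.2)]
  congr 1
  exact Finset.sum_congr rfl fun j _ => by rw [congrFun h2 j]

theorem exists_sobolevH1_test (hφ : ContDiffOn ℝ ∞ φ Ω) (ψ : 𝓓(Ω, ℂ)) :
    ∃ t : sobolevH1 hφ, neumannEmbedding hφ t = testToL2 ψ := by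
  obtain ⟨t, ht, -⟩ := exists_sobolevH1_of_hasWittenGradient hφ (hasWittenGradient_test hφ ψ)
  exact ⟨t, ht⟩

/-- Multiplication by e^{±φ/2} preserves test functions, so the core of H¹₀ matches the domain of -Δ
+ V₁. -/
theorem mem_testSubspace_iff (hφ : ContDiffOn ℝ ∞ φ Ω) (w : sobolevH1 hφ) :
    w ∈ testSubspace hφ ↔ ∃ ψ : 𝓓(Ω, ℂ), neumannEmbedding hφ w = testToL2 ψ := by
  constructor
  · rintro ⟨ψ, hψ⟩
    refine ⟨testMul _ (contDiffOn_cexp hφ (-1 / 2)) ψ, Lp.ext ?_⟩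
    filter_upwards [coeFn_weightEquiv hφ w.1.fst, (ae_weighted_iff hφ).1 hψ,
      coeFn_testToL2 (testMul _ (contDiffOn_cexp hφ (-1 / 2)) ψ)] with x h1 h2 h3
    rw [h3, testMul_apply, ← h2]
    exact h1
  · rintro ⟨ψ, hψ⟩
    refine ⟨testMul _ (contDiffOn_cexp hφ (1 / 2)) ψ, (ae_weighted_iff hφ).2 ?_⟩
    have h := coeFn_weightEquiv hφ w.1.fst
    rw [← neumannEmbedding_apply, hψ] at h
    filter_upwards [h, coeFn_testToL2 ψ] with x h1 h2
    rw [testMul_apply, ← h2, h1, cexp_mul_cexp_mul]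
    rfl

theorem exists_mem_testSubspace (hφ : ContDiffOn ℝ ∞ φ Ω)
    (x : (schrodingerOperator Ω (potential φ)).domain) :
    ∃ t ∈ testSubspace hφ, neumannEmbedding hφ t = x := by
  obtain ⟨ψ, hψ, -⟩ := exists_test_of_mem_domain hφ x
  obtain ⟨t, ht⟩ := exists_sobolevH1_test hφ ψ
  exact ⟨t, (mem_testSubspace_iff hφ t).2 ⟨ψ, ht⟩, ht.trans hψ⟩

theorem neumannEmbedding_mem_domain (hφ : ContDiffOn ℝ ∞ φ Ω) (t : sobolevH1 hφ)
    (ht : t ∈ testSubspace hφ) :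
    neumannEmbedding hφ t ∈ (schrodingerOperator Ω (potential φ)).domain := by
  obtain ⟨ψ, hψ⟩ := (mem_testSubspace_iff hφ t).1 ht
  exact hψ ▸ testToL2_mem_domain hφ ψ

theorem inner_sobolevH1_of_mem_domain (hφ : ContDiffOn ℝ ∞ φ Ω) (t : sobolevH1 hφ)
    (x : (schrodingerOperator Ω (potential φ)).domain) (hx : neumannEmbedding hφ t = x)
    (v : sobolevH1 hφ) :
    ⟪t, v⟫_ℂ = ⟪(x : L2 Ω) + schrodingerOperator Ω (potential φ) x, neumannEmbedding hφ v⟫_ℂ := by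
  obtain ⟨ψ, hψ, hSψ⟩ := exists_test_of_mem_domain hφ x
  rw [inner_sobolevH1_of_test hφ (hx.trans hψ.symm), hψ, hSψ]

set_option maxHeartbeats 1000000 in
theorem isFormOperator_neumannRealization (hφ : ContDiffOn ℝ ∞ φ Ω) :
    IsFormOperator (V := sobolevH1 hφ) (neumannRealization Ω φ) (neumannEmbedding hφ) := by
  intro u y
  have hd := dense_domain_schrodingerOperator hφ
  rw [neumannRealization, mem_graph_domRestrict_iff]
  constructor
  · rintro ⟨⟨y', hy', g, hg, hq⟩, hy⟩
    -- The function in Green's formula is the value of the adjoint, which is single-valued.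
    obtain rfl : y' = y := LinearPMap.mem_graph_snd_inj _ hy' hy rfl
    obtain ⟨w, hw, hwg⟩ := exists_sobolevH1_of_hasWittenGradient hφ hg
    refine ⟨w, hw, fun v => ?_⟩
    rw [inner_sobolevH1, hw, inner_add_right, add_comm]
    congr 1
    simp only [hwg]
    exact hq _ _ ((mem_sobolevH1_iff hφ v.1).1 v.2)
  · rintro ⟨w, rfl, hw⟩
    -- Pairing with test functions alone already gives -Δu + V₁u = y weakly; pairing with all of H¹
    -- below adds the natural boundary condition.
    have hy : (neumannEmbedding hφ w, y) ∈ ((schrodingerOperator Ω (potential φ))†).graph := by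
      rw [mem_graph_adjoint_iff hd]
      intro x
      obtain ⟨t, -, ht⟩ := exists_mem_testSubspace hφ x
      have e := inner_sobolevH1_of_mem_domain hφ t x ht w
      rw [hw, ht, inner_add_left, inner_add_right, add_comm] at e
      exact (add_left_cancel e).symm
    refine ⟨⟨y, hy, _, (mem_sobolevH1_iff hφ w.1).1 w.2, fun v h hv => ?_⟩, hy⟩
    obtain ⟨t, rfl, ht⟩ := exists_sobolevH1_of_hasWittenGradient hφ hv
    have e := hw t
    rw [inner_sobolevH1, inner_add_right, add_comm] at e
    simp only [← ht]
    exact add_right_cancel e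

set_option maxHeartbeats 1000000 in
theorem dirichletRealization_hasCompactResolvent_iff (hφ : ContDiffOn ℝ ∞ φ Ω) :
    HasCompactResolvent (dirichletRealization hφ) ↔
      IsCompactOperator fun w : sobolevH10 hφ => neumannEmbedding hφ w := by
  have key := friedrichsExtension_hasCompactResolvent_iff (V := sobolevH1 hφ)
    (S := schrodingerOperator Ω (potential φ)) (hS := isNonnegOperator_schrodinger hφ)
    (T := testSubspace hφ) (J := neumannEmbedding hφ) (dense_domain_schrodingerOperator hφ)
    (exists_mem_testSubspace hφ) (neumannEmbedding_mem_domain hφ)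
    (fun t _ => inner_sobolevH1_of_mem_domain hφ t) (sobolevH10 hφ) rfl
  exact key

end WeightedSobolev

end

/-! ### The two equivalences -/

theorem mainTheorem5 (n : ℕ) (Ω : TopologicalSpace.Opens (EuclideanSpace ℝ (Fin n)))
    (φ : EuclideanSpace ℝ (Fin n) → ℝ) (hφ : ContDiffOn ℝ ∞ φ Ω) :
    (IsCompactOperator (WeightedSobolev.embeddingH10 hφ) ↔
      WeightedSobolev.HasCompactResolvent (WeightedSobolev.dirichletRealization hφ)) ∧
    (IsCompactOperator (WeightedSobolev.embeddingH1 hφ) ↔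
      WeightedSobolev.HasCompactResolvent (WeightedSobolev.neumannRealization Ω φ)) :=
  -- Composing with the unitary map does not affect compactness of the injections.
  ⟨(WeightedSobolev.isCompactOperator_weightEquiv_comp_iff hφ _).symm.trans
      (WeightedSobolev.dirichletRealization_hasCompactResolvent_iff hφ).symm,
    (WeightedSobolev.isCompactOperator_weightEquiv_comp_iff hφ _).symm.trans
      (WeightedSobolev.isFormOperator_neumannRealization hφ).hasCompactResolvent_iff.symm⟩
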